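/- Let $m>0$ be real. Consider the multicluster fluctuating two-ray (MFTR) model with $\mu\in\{1,2,\dots\}$ clusters: let $\sigma>0$, $E_s,N_0>0$ and amplitudes $V_1,V_2,U_2,\dots,U_\mu\ge 0$ be constants; let $\zeta$ be Gamma distributed with density $m^m x^{m-1}e^{-mx}/\Gamma(m)$ on $x>0$, let $\phi_1,\phi_2,\varphi_2,\dots,\varphi_\mu$ be uniform on $(0,2\pi)$, and let $X_i,Y_i\sim\mathcal N(0,\sigma^2)$ for $1\le i\le\mu$, all mutually independent; put $Z_i=X_i+jY_i$ and $$\gamma=\frac{E_s}{N_0}\Big(\big|\sqrt\zeta\,(V_1e^{j\phi_1}+V_2e^{j\phi_2})+Z_1\big|^2+\sum_{i=2}^{\mu}\big|\sqrt\zeta\,U_ie^{j\varphi_i}+Z_i\big|^2\Big),\qquad \overline\gamma=\mathbb E\{\gamma\},$$ $$K=\frac{V_1^2+V_2^2+\sum_{i=2}^\mu U_i^2}{2\sigma^2\mu},\qquad \Delta=\frac{2V_1V_2}{V_1^2+V_2^2+\sum_{i=2}^\mu U_i^2}\in[0,1]$$ (with $\Delta=0$ if all amplitudes vanish). More generally,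 for real $\mu>0$, $K\ge0$, $\Delta\in[0,1]$, $\overline\gamma>0$, let $\gamma$ have the MFTR law with real $\mu$: with $p=\overline\gamma/(\mu(1+K))$, and with $\zeta$ as above independent of $\theta$ uniform on $(0,2\pi)$, the conditional density of $\gamma$ given $(\zeta,\theta)$ is the $\kappa$-$\mu$ density with dominant power $d=\zeta\,p\,\mu K(1+\Delta\cos\theta)$, namely $$\frac1p\Big(\frac xd\Big)^{\frac{\mu-1}2}e^{-(x+d)/p}\,I_{\mu-1}\!\Big(\frac{2\sqrt{dx}}p\Big),\qquad x>0,$$ where $I_\nu$ is the modified Bessel function of the first kind (for $d=0$: the Gamma density $x^{\mu-1}e^{-x/p}/(\Gamma(\mu)p^\mu)$). In both settings the law of $\gamma$ is an infinite discrete mixture of Gamma distributions: it has a density $f_\gamma$ vanishing on $x\le 0$, and $$f_\gamma(x)=\sum_{i=0}^\infty w_i\, f_X^{\rm G}\Big(\mu+i;\tfrac{\overline\gamma(\mu+i)}{\mu(K+1)};x\Big)\ (x>0),\qquad F_\gamma(x)=\sum_{i=0}^\infty w_i\, F_X^{\rm G}\Big(\mu+i;\tfrac{\overline\gamma(\mu+i)}{\mu(K+1)};x\Big)\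 (x\ge0),$$ with both series convergent, where $$f_X^{\rm G}(\lambda;\nu;y)=\frac{\lambda^\lambda}{\Gamma(\lambda)\nu^\lambda}y^{\lambda-1}e^{-\lambda y/\nu},\qquad F_X^{\rm G}(\lambda;\nu;y)=\frac1{\Gamma(\lambda)}\int_0^{\lambda y/\nu}t^{\lambda-1}e^{-t}\,dt$$ are the density and distribution function of the Gamma law with shape $\lambda$ and mean $\nu$, and the weights satisfy $w_i\ge0$, $\sum_{i=0}^\infty w_i=1$ and are given by $$w_i=\frac{\Gamma(m+i)(\mu K)^i m^m}{\Gamma(m)\Gamma(i+1)}\,\frac{(1-\Delta)^i}{\sqrt\pi\,(\mu K(1-\Delta)+m)^{m+i}}\sum_{q=0}^i\binom iq\frac{\Gamma(q+\frac12)}{\Gamma(q+1)}\Big(\frac{2\Delta}{1-\Delta}\Big)^q{}_2F_1\Big(m+i,q+\tfrac12;q+1;\tfrac{-2\mu K\Delta}{\mu K(1-\Delta)+m}\Big).$$ For $\Delta=1$ the product $(1-\Delta)^i\big(\tfrac{2\Delta}{1-\Delta}\big)^q$ is read as $(1-\Delta)^{i-q}(2\Delta)^q$ with $0^0=1$. Here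 ${}_2F_1$ is the Gauss hypergeometric function, analytically continued to $(-\infty,1)$. -/

import Mathlib

open MeasureTheory ProbabilityTheory Set

noncomputable section

namespace MFTR

/-! ### Special functions -/

/-- `F` is a real-analytic continuation to `(-∞, 1)` of the Gauss hypergeometric series
`∑ₙ (a)ₙ (b)ₙ / ((c)ₙ n!) xⁿ`, which converges for `|x| < 1`. -/
def IsGaussContinuation (a b c : ℝ) (F : ℝ → ℝ) : Prop :=
  AnalyticOnNhd ℝ F (Iio 1) ∧ ∀ x : ℝ, |x| < 1 → F x = ordinaryHypergeometric a b c x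

open Classical in
/-- The Gauss hypergeometric function `₂F₁(a, b; c; z)` for real parameters and real `z < 1`:
the analytic continuation to `(-∞, 1)` of the Gauss series (unique by the next lemma).
Mathlib's `ordinaryHypergeometric` is only the sum of the series, hence meaningful for
`|z| < 1` only. -/
def gaussHyp (a b c z : ℝ) : ℝ :=
  if h : ∃ F : ℝ → ℝ, IsGaussContinuation a b c F then Classical.choose h z else 0

/-- The analytic continuation defining `gaussHyp` is unique on `(-∞, 1)`. -/
theorem gaussHyp_eq {a b c : ℝ} {F : ℝ → ℝ} (hF : IsGaussContinuation a b c F)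
    {z : ℝ} (hz : z < 1) : gaussHyp a b c z = F z := by
  have h : ∃ F : ℝ → ℝ, IsGaussContinuation a b c F := ⟨F, hF⟩
  have hG : IsGaussContinuation a b c (Classical.choose h) := Classical.choose_spec h
  rw [gaussHyp, dif_pos h]
  refine hG.1.eqOn_of_preconnected_of_eventuallyEq hF.1 isPreconnected_Iio
    (z₀ := 0) (by simp) ?_ hz
  have hnhds : Ioo (-1 : ℝ) 1 ∈ nhds (0 : ℝ) := Ioo_mem_nhds (by norm_num) (by norm_num)
  filter_upwards [hnhds] with x hx
  rw [hG.2 x (abs_lt.mpr hx), hF.2 x (abs_lt.mpr hx)]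

/-- The lower incomplete gamma function `γ(a, x) = ∫₀ˣ t^(a-1) e^(-t) dt`. -/
def lowerGamma (a x : ℝ) : ℝ := ∫ t in (0 : ℝ)..x, t ^ (a - 1) * Real.exp (-t)

/-- The modified Bessel function of the first kind,
`I_ν(z) = ∑ₖ (z/2)^(2k+ν) / (k! Γ(k+ν+1))`, for real `ν > -1` and `z > 0`. -/
def besselI (ν z : ℝ) : ℝ :=
  ∑' k : ℕ, (z / 2) ^ (2 * (k : ℝ) + ν) / (k.factorial * Real.Gamma (k + ν + 1))

/-! ### Gamma densities, distribution functions and mixtures -/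

/-- Density at `y > 0` of the Gamma law with shape `l` and mean `v`. -/
def gammaShapePDF (l v y : ℝ) : ℝ :=
  l ^ l / (Real.Gamma l * v ^ l) * y ^ (l - 1) * Real.exp (-(l * y / v))

/-- Distribution function at `y ≥ 0` of the Gamma law with shape `l` and mean `v`. -/
def gammaShapeCDF (l v y : ℝ) : ℝ :=
  1 / Real.Gamma l * lowerGamma l (l * y / v)

/-- The law `ν` on `ℝ` is the discrete mixture, with weights `w i`, of the Gamma laws with shapes
`l i` and means `v i`: the weights form a probability distribution on `ℕ`; `ν` has the probability
density function `∑ᵢ wᵢ f(lᵢ; vᵢ; x)` on `x > 0` (a convergent series) and `0` elsewhere; its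
distribution function is `∑ᵢ wᵢ F(lᵢ; vᵢ; x)` for every `x ≥ 0`. -/
def IsGammaMixture (ν : Measure ℝ) (w l v : ℕ → ℝ) : Prop :=
  (∀ i, 0 ≤ w i) ∧ HasSum w 1 ∧
  (∀ x : ℝ, 0 < x → Summable fun i => w i * gammaShapePDF (l i) (v i) x) ∧
  ν = volume.withDensity (fun x : ℝ =>
    ENNReal.ofReal (if 0 < x then ∑' i, w i * gammaShapePDF (l i) (v i) x else 0)) ∧
  ∀ x : ℝ, 0 ≤ x → HasSum (fun i => w i * gammaShapeCDF (l i) (v i) x) (ν.real (Iic x))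

/-- The mixture weights. For `Δ < 1` the factor `(1 - Δ)^(i-q) (2Δ)^q` equals
`(1 - Δ)^i (2Δ / (1 - Δ))^q` (see the next lemma); the form used here also makes sense at `Δ = 1`,
where it is the limit as `Δ → 1`. -/
def weight (K m μ Δ : ℝ) (i : ℕ) : ℝ :=
  Real.Gamma (m + i) * (μ * K) ^ i * m ^ m / (Real.Gamma m * Real.Gamma (i + 1)) *
  (1 / (Real.sqrt Real.pi * (μ * K * (1 - Δ) + m) ^ (m + i))) *
  ∑ q ∈ Finset.range (i + 1),
    (i.choose q : ℝ) * (Real.Gamma (q + 1 / 2) / Real.Gamma (q + 1)) *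
      ((1 - Δ) ^ (i - q) * (2 * Δ) ^ q) *
      gaussHyp (m + i) (q + 1 / 2) (q + 1) (-(2 * μ * K * Δ) / (μ * K * (1 - Δ) + m))

theorem weight_eq_of_lt_one (K m μ : ℝ) {Δ : ℝ} (hΔ : Δ < 1) (i : ℕ) :
    weight K m μ Δ i =
      Real.Gamma (m + i) * (μ * K) ^ i * m ^ m / (Real.Gamma m * Real.Gamma (i + 1)) *
      ((1 - Δ) ^ i / (Real.sqrt Real.pi * (μ * K * (1 - Δ) + m) ^ (m + i))) *
      ∑ q ∈ Finset.range (i + 1),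
        (i.choose q : ℝ) * (Real.Gamma (q + 1 / 2) / Real.Gamma (q + 1)) *
          (2 * Δ / (1 - Δ)) ^ q *
          gaussHyp (m + i) (q + 1 / 2) (q + 1) (-(2 * μ * K * Δ) / (μ * K * (1 - Δ) + m)) := by
  have h1 : (1 - Δ) ≠ 0 := by linarith
  unfold weight
  rw [Finset.mul_sum, Finset.mul_sum]
  refine Finset.sum_congr rfl fun q hq => ?_
  have hqi : q ≤ i := Nat.lt_succ_iff.mp (Finset.mem_range.mp hq)
  have h2 : (1 - Δ) ^ i = (1 - Δ) ^ (i - q) * (1 - Δ) ^ q := by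
    rw [← pow_add, Nat.sub_add_cancel hqi]
  have h3 : (1 - Δ) ^ i * (2 * Δ / (1 - Δ)) ^ q = (1 - Δ) ^ (i - q) * (2 * Δ) ^ q := by
    rw [h2, div_pow, mul_assoc, mul_div_cancel₀ _ (pow_ne_zero q h1)]
  rw [← h3]
  ring

/-! ### The physical model: `n + 1` clusters of waves -/

/-- The uniform distribution on `(0, 2π)`. -/
def uniformPhase : Measure ℝ := cond volume (Ioo 0 (2 * Real.pi))

/-- The random quantities of the model with `n + 1` clusters: a unit-mean Gamma variable `ζ` of
shape `m`, phases `φ₁, φ₂` (first cluster) and `ϑ i` (additional clusters) uniform on `(0, 2π)`,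
centred Gaussian in-phase and quadrature diffuse components `X i`, `Y i` of variance `σ²`; all of
them mutually independent. -/
structure IsModel {Ω : Type*} [MeasurableSpace Ω] (P : Measure Ω) {n : ℕ} (m σ : ℝ)
    (ζ φ₁ φ₂ : Ω → ℝ) (ϑ : Fin n → Ω → ℝ) (X Y : Fin (n + 1) → Ω → ℝ) : Prop where
  law_fluctuation : HasLaw ζ (gammaMeasure m m) P
  law_phase₁ : HasLaw φ₁ uniformPhase P
  law_phase₂ : HasLaw φ₂ uniformPhase P
  law_phase : ∀ i, HasLaw (ϑ i) uniformPhase P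
  law_inPhase : ∀ i, HasLaw (X i) (gaussianReal 0 (σ ^ 2).toNNReal) P
  law_quadrature : ∀ i, HasLaw (Y i) (gaussianReal 0 (σ ^ 2).toNNReal) P
  indep : iIndepFun
    (Sum.elim ![ζ, φ₁, φ₂] (Sum.elim ϑ (Sum.elim X Y)) :
      Fin 3 ⊕ (Fin n ⊕ (Fin (n + 1) ⊕ Fin (n + 1))) → Ω → ℝ) P

/-- The received power
`R² = |√ζ (V₁ e^(jφ₁) + V₂ e^(jφ₂)) + Z₁|² + ∑_{i ≥ 2} |√ζ Uᵢ e^(jϑᵢ) + Zᵢ|²`, `Zᵢ = Xᵢ + j Yᵢ`. -/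
def power {Ω : Type*} {n : ℕ} (V₁ V₂ : ℝ) (U : Fin n → ℝ)
    (ζ φ₁ φ₂ : Ω → ℝ) (ϑ : Fin n → Ω → ℝ) (X Y : Fin (n + 1) → Ω → ℝ) (ω : Ω) : ℝ :=
  ‖(Real.sqrt (ζ ω) : ℂ) *
      (V₁ * Complex.exp (Complex.I * φ₁ ω) + V₂ * Complex.exp (Complex.I * φ₂ ω)) +
      ((X 0 ω : ℂ) + Complex.I * Y 0 ω)‖ ^ 2 +
  ∑ i : Fin n, ‖(Real.sqrt (ζ ω) : ℂ) * (U i * Complex.exp (Complex.I * ϑ i ω)) +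
      ((X i.succ ω : ℂ) + Complex.I * Y i.succ ω)‖ ^ 2

/-- The ratio `K` of specular to diffuse power. -/
def paramK {n : ℕ} (σ V₁ V₂ : ℝ) (U : Fin n → ℝ) : ℝ :=
  (V₁ ^ 2 + V₂ ^ 2 + ∑ i, U i ^ 2) / (2 * σ ^ 2 * ((n : ℝ) + 1))

/-- The parameter `Δ` (equal to `0` if all specular amplitudes vanish). -/
def paramΔ {n : ℕ} (V₁ V₂ : ℝ) (U : Fin n → ℝ) : ℝ :=
  2 * V₁ * V₂ / (V₁ ^ 2 + V₂ ^ 2 + ∑ i, U i ^ 2)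

/-! ### The extension to a real number `μ > 0` of clusters -/

/-- The `κ`-`μ` density at `x > 0`, for a real number `μ > 0` of clusters, diffuse power `p > 0` per
cluster and total dominant power `d ≥ 0` (so `κ = d / (μ p)` and the mean power is `d + μ p`); for
`d = 0` it is the Gamma density, its limit as `d → 0`. For natural `μ` this is the density of
`∑_{i ≤ μ} |Zᵢ + pᵢ|²` with `E|Zᵢ|² = p`, `∑ |pᵢ|² = d`. -/
def kappaMuPDF (μ p d x : ℝ) : ℝ :=
  if 0 < d then
    1 / p * (x / d) ^ ((μ - 1) / 2) * Real.exp (-(x + d) / p) *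
      besselI (μ - 1) (2 * Real.sqrt (d * x) / p)
  else x ^ (μ - 1) * Real.exp (-x / p) / (Real.Gamma μ * p ^ μ)

/-- The MFTR law of the SNR for real `μ > 0` and mean SNR `g`. Given the unit-mean Gamma
fluctuation `z` of shape `m` and the phase difference `θ` of the two specular components of the
first cluster, independent and `θ` uniform on `(0, 2π)`, the SNR is `κ`-`μ` distributed with diffuse
power `p = g / (μ (1 + K))` per cluster and dominant power `z p μ K (1 + Δ cos θ)`. -/
def mftrLaw (K m μ Δ g : ℝ) : Measure ℝ :=
  volume.withDensity (fun x : ℝ =>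
    ∫⁻ a : ℝ × ℝ, ENNReal.ofReal (if 0 < x then
        kappaMuPDF μ (g / (μ * (1 + K)))
          (a.1 * (g / (μ * (1 + K))) * (μ * K * (1 + Δ * Real.cos a.2))) x
      else 0) ∂((gammaMeasure m m).prod uniformPhase))

end MFTR

end

noncomputable section

open scoped ENNReal

namespace MFTR

/-! ### Integrals against Gamma laws -/

/-! Given the fluctuation z and the phase difference θ, the SNR is a scaled noncentral chi-square
variable, and such a law is a Poisson mixture of Gamma laws with shapes μ + k, a common rate r and
Poisson parameter s = z μ K (1 + Δ cos θ). Only the Poisson weights depend on (z, θ), so averaging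
over (z, θ) acts on the weights alone and the result is again a mixture of the same Gamma laws
(`gammaMix`). Nonnegativity and total mass 1 come from the Poisson law.

The averaged weights are computed in closed form. The Gamma average of a Poisson probability is
negative binomial (`lintegral_poissonWeight_gammaMeasure`). For the average over θ put t =
cos²(θ/2): then s is affine in t, the binomial theorem splits its i-th power, and each remaining
integral is Euler's integral for ₂F₁ (`isGaussContinuation_integral_halfCos`, `weight_eq_integral`).
Hence `ofReal_weight`.

For real μ the Poisson mixture is the Bessel series read term by term (`hasSum_kappaMuPDF`). For the
physical model it follows from moment generating functions of squared Gaussians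
(`map_sum_add_sq_eq_gammaMix`), and the difference of two uniform phases may be replaced by one
uniform phase. The mean of the mixture then identifies the rate as r = μ(K + 1)/g. -/

theorem lintegral_gammaMeasure_of_tilt {a r a' r' c : ℝ} (ha : 0 < a) (hr : 0 < r)
    (ha' : 0 < a') (hr' : 0 < r') (hc : 0 ≤ c) {f : ℝ → ℝ} (hf : Measurable f)
    (h : ∀ x, 0 < x → f x * gammaPDFReal a r x = c * gammaPDFReal a' r' x) :
    ∫⁻ x, ENNReal.ofReal (f x) ∂gammaMeasure a r = ENNReal.ofReal c := by
  have hm : ∀ a r, Measurable (gammaPDF a r) := fun a r =>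
    (measurable_gammaPDFReal a r).ennreal_ofReal
  rw [gammaMeasure, lintegral_withDensity_eq_lintegral_mul _ (hm a r) hf.ennreal_ofReal]
  -- The tilting identity is known only for x > 0; the origin is a null set.
  have h0 : ∀ᵐ x : ℝ, x ≠ 0 := by simp [ae_iff]
  have : ∀ᵐ x : ℝ, (gammaPDF a r * fun x => ENNReal.ofReal (f x)) x =
      ENNReal.ofReal c * gammaPDF a' r' x := by
    filter_upwards [h0] with x hx
    rcases lt_or_gt_of_ne hx with hx | hx
    · simp [gammaPDF_of_neg hx]
    · rw [Pi.mul_apply, gammaPDF, gammaPDF, ← ENNReal.ofReal_mul hc, ← h x hx,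
        ENNReal.ofReal_mul' (gammaPDFReal_nonneg ha hr x), mul_comm]
  rw [lintegral_congr_ae this, lintegral_const_mul _ (hm a' r'),
    lintegral_gammaPDF_eq_one ha' hr', mul_one]

theorem lintegral_exp_mul_gammaMeasure {a r t : ℝ} (ha : 0 < a) (hr : 0 < r) (ht : t < r) :
    ∫⁻ x, ENNReal.ofReal (Real.exp (t * x)) ∂gammaMeasure a r =
      ENNReal.ofReal ((r / (r - t)) ^ a) := by
  have hrt : 0 < r - t := sub_pos.2 ht
  refine lintegral_gammaMeasure_of_tilt ha hr ha hrt (by positivity) (by fun_prop) ?_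
  intro x hx
  rw [gammaPDFReal, gammaPDFReal, if_pos hx.le, if_pos hx.le, Real.div_rpow hr.le hrt.le,
    show -((r - t) * x) = t * x + -(r * x) by ring, Real.exp_add]
  have := (Real.rpow_pos_of_pos hrt a).ne'
  field_simp

theorem lintegral_id_gammaMeasure {a r : ℝ} (ha : 0 < a) (hr : 0 < r) :
    ∫⁻ x, ENNReal.ofReal x ∂gammaMeasure a r = ENNReal.ofReal (a / r) := by
  refine lintegral_gammaMeasure_of_tilt (a' := a + 1) ha hr (by positivity) hr (by positivity)
    measurable_id ?_
  intro x hx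
  rw [gammaPDFReal, gammaPDFReal, if_pos hx.le, if_pos hx.le, Real.rpow_add hr,
    Real.Gamma_add_one ha.ne', Real.rpow_one, show a + 1 - 1 = (a - 1) + 1 by ring,
    Real.rpow_add hx, Real.rpow_one]
  have := (Real.Gamma_pos_of_pos ha).ne'
  field_simp

/-- The probability of `k` under the Poisson law of parameter `s`. -/
def poissonWeight (s : ℝ) (k : ℕ) : ℝ := Real.exp (-s) * s ^ k / k.factorial

theorem poissonWeight_nonneg {s : ℝ} (hs : 0 ≤ s) (k : ℕ) : 0 ≤ poissonWeight s k := by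
  unfold poissonWeight; positivity

@[fun_prop]
theorem continuous_poissonWeight (k : ℕ) : Continuous fun s => poissonWeight s k := by
  unfold poissonWeight; fun_prop

/-- Probability generating function of the Poisson law; q = 1 gives the total mass, q = r / (r - t)
the moment generating function of a Gamma mixture. -/
theorem hasSum_poissonWeight_mul_pow (s q : ℝ) :
    HasSum (fun k => poissonWeight s k * q ^ k) (Real.exp (s * (q - 1))) := by
  have h := (NormedSpace.expSeries_div_hasSum_exp (s * q)).mul_left (Real.exp (-s))
  rw [← Real.exp_eq_exp_ℝ, ← Real.exp_add, show -s + s * q = s * (q - 1) by ring] at h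
  refine h.congr_fun ?_ 
  intro k
  simp only [poissonWeight, mul_pow]
  ring

theorem hasSum_poissonWeight (s : ℝ) : HasSum (poissonWeight s) 1 := by
  simpa using hasSum_poissonWeight_mul_pow s 1

theorem hasSum_poissonWeight_mul_natCast (s : ℝ) :
    HasSum (fun k => poissonWeight s k * (k : ℝ)) s := by
  -- The term k = 0 vanishes, and (k + 1) / (k + 1)! = 1 / k! turns the shifted series into s times
  -- the total mass.
  rw [← hasSum_nat_add_iff' 1]
  have h := (hasSum_poissonWeight s).mul_left s
  simp only [Finset.range_one, Finset.sum_singleton, Nat.cast_zero, mul_zero, sub_zero]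
  rw [mul_one] at h
  refine h.congr_fun ?_
  intro k
  simp only [poissonWeight, Nat.factorial_succ, pow_succ]
  push_cast
  have : (k.factorial : ℝ) ≠ 0 := by positivity
  field_simp

/-- The integrand times the Gamma density is proportional to the density of shape m + i and rate s +
m, so a Poisson law with Gamma parameter is negative binomial. -/
theorem lintegral_poissonWeight_gammaMeasure {m s : ℝ} (hm : 0 < m) (hs : 0 ≤ s) (i : ℕ) :
    ∫⁻ z, ENNReal.ofReal (poissonWeight (z * s) i) ∂gammaMeasure m m =
      ENNReal.ofReal (Real.Gamma (m + i) * m ^ m / (Real.Gamma m * Real.Gamma (i + 1)) *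
        (s ^ i / (s + m) ^ (m + i))) := by
  have hG := Real.Gamma_pos_of_pos hm
  have hG' : 0 < Real.Gamma (m + i) := Real.Gamma_pos_of_pos (by positivity)
  have hsm : 0 < s + m := by positivity
  refine lintegral_gammaMeasure_of_tilt (a' := m + i) (r' := s + m) hm hm (by positivity) hsm ?_
    (by fun_prop) ?_
  · rw [Real.Gamma_nat_eq_factorial]; positivity
  intro x hx
  rw [gammaPDFReal, gammaPDFReal, if_pos hx.le, if_pos hx.le, Real.Gamma_nat_eq_factorial,
    show m + (i : ℝ) - 1 = (m - 1) + i by ring, Real.rpow_add hx, Real.rpow_natCast,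
    show -((s + m) * x) = -(x * s) + -(m * x) by ring, Real.exp_add, poissonWeight, mul_pow]
  have := (Real.rpow_pos_of_pos hsm (m + i)).ne'
  have : (i.factorial : ℝ) ≠ 0 := by positivity
  field_simp

/-! ### Mixtures of Gamma laws of common rate -/

/-- The mixture, with weights `w k`, of the Gamma laws of shapes `μ + k` and rate `r`. -/
def gammaMix (w : ℕ → ℝ≥0∞) (μ r : ℝ) : Measure ℝ :=
  Measure.sum fun k : ℕ => w k • gammaMeasure (μ + k) r

theorem lintegral_gammaMix (w : ℕ → ℝ≥0∞) (μ r : ℝ) (f : ℝ → ℝ≥0∞) :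
    ∫⁻ x, f x ∂gammaMix w μ r = ∑' k, w k * ∫⁻ x, f x ∂gammaMeasure (μ + k) r := by
  simp [gammaMix, lintegral_sum_measure]

theorem gammaMix_apply (w : ℕ → ℝ≥0∞) (μ r : ℝ) {s : Set ℝ} (hs : MeasurableSet s) :
    gammaMix w μ r s = ∑' k, w k * gammaMeasure (μ + k) r s := by
  simp [gammaMix, Measure.sum_apply _ hs]

theorem isProbabilityMeasure_gammaMix {w : ℕ → ℝ≥0∞} {μ r : ℝ} (hμ : 0 < μ) (hr : 0 < r)
    (hw : ∑' k, w k = 1) : IsProbabilityMeasure (gammaMix w μ r) := by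
  constructor
  rw [gammaMix_apply _ _ _ MeasurableSet.univ, ← hw]
  refine tsum_congr fun k => ?_
  have := isProbabilityMeasure_gammaMeasure (a := μ + k) (by positivity) hr
  simp

theorem gammaShapePDF_eq_gammaPDFReal {l v y : ℝ} (hl : 0 < l) (hv : 0 < v) (hy : 0 < y) :
    gammaShapePDF l v y = gammaPDFReal l (l / v) y := by
  rw [gammaShapePDF, gammaPDFReal, if_pos hy.le, Real.div_rpow hl.le hv.le]
  have := (Real.rpow_pos_of_pos hv l).ne'
  have := (Real.Gamma_pos_of_pos hl).ne'
  rw [show l / v * y = l * y / v by ring]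
  field_simp

theorem gammaShapeCDF_eq_real {l v y : ℝ} (hl : 0 < l) (hv : 0 < v) (hy : 0 ≤ y) :
    gammaShapeCDF l v y = (gammaMeasure l (l / v)).real (Iic y) := by
  have hr : 0 < l / v := by positivity
  set r := l / v with hrdef
  have := isProbabilityMeasure_gammaMeasure hl hr
  rw [← cdf_eq_real, cdf_gammaMeasure_eq_integral hl hr, gammaShapeCDF, lowerGamma,
    show l * y / v = r * y by rw [hrdef]; ring]
  have h1 : ∫ x in Iic y, gammaPDFReal l r x = ∫ x in (0 : ℝ)..y, gammaPDFReal l r x := by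
    rw [intervalIntegral.integral_of_le hy]
    refine setIntegral_eq_of_subset_of_ae_sdiff_eq_zero
      measurableSet_Iic.nullMeasurableSet Ioc_subset_Iic_self ?_
    have h0 : ∀ᵐ x : ℝ, x ≠ 0 := by simp [ae_iff]
    filter_upwards [h0] with x hx hx'
    have : x < 0 := by
      simp only [mem_sdiff, mem_Iic, mem_Ioc, not_and, not_le] at hx'
      rcases lt_or_gt_of_ne hx with h | h
      · exact h
      · exact absurd (hx'.2 h) (not_lt.2 hx'.1)
    simp [gammaPDFReal, not_le.2 this]
  have h2 : ∫ x in (0 : ℝ)..y, gammaPDFReal l r x =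
      ∫ x in (0 : ℝ)..y, (1 / Real.Gamma l * r) * ((r * x) ^ (l - 1) * Real.exp (-(r * x))) := by
    refine intervalIntegral.integral_congr fun x hx => ?_
    rw [uIcc_of_le hy] at hx
    simp only [gammaPDFReal, if_pos hx.1]
    rw [Real.mul_rpow hr.le hx.1, Real.rpow_sub_one hr.ne']
    field_simp
  rw [h1, h2, intervalIntegral.integral_const_mul,
    intervalIntegral.integral_comp_mul_left (fun t => t ^ (l - 1) * Real.exp (-t)) hr.ne',
    mul_zero, smul_eq_mul]
  field_simp

/-- Consecutive terms have ratio r x / (μ + k), which tends to 0. Since mixture weights are at most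
1, this series dominates every mixture density. -/
theorem summable_gammaPDFReal {μ r x : ℝ} (hμ : 0 < μ) (hr : 0 < r) (hx : 0 < x) :
    Summable fun k : ℕ => gammaPDFReal (μ + k) r x := by
  have hpos : ∀ k : ℕ, 0 < gammaPDFReal (μ + k) r x := fun k =>
    gammaPDFReal_pos (by positivity) hr hx
  refine summable_of_ratio_test_tendsto_lt_one (l := 0) one_pos
    (Filter.Eventually.of_forall fun k => (hpos k).ne') ?_
  have h : ∀ k : ℕ, ‖gammaPDFReal (μ + (k + 1 : ℕ)) r x‖ / ‖gammaPDFReal (μ + k) r x‖ =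
      (r * x) / (μ + k) := by
    intro k
    have hk : 0 < μ + k := by positivity
    rw [Real.norm_of_nonneg (hpos _).le, Real.norm_of_nonneg (hpos _).le, gammaPDFReal,
      gammaPDFReal, if_pos hx.le, if_pos hx.le]
    push_cast
    rw [← add_assoc, Real.Gamma_add_one hk.ne', show μ + k + 1 - 1 = (μ + k - 1) + 1 by ring,
      Real.rpow_add_one hr.ne', Real.rpow_add_one hx.ne']
    have := (Real.Gamma_pos_of_pos hk).ne'
    have := (Real.rpow_pos_of_pos hx (μ + k - 1)).ne'
    have := (Real.rpow_pos_of_pos hr (μ + k)).ne'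
    field_simp
  simp_rw [h]
  exact Filter.Tendsto.const_div_atTop
    (Filter.tendsto_atTop_add_const_left _ _ tendsto_natCast_atTop_atTop) _

/-- Shape divided by mean is μ(K + 1)/g for every i, so the components share one rate. What remains
is the passage between sums in `ℝ≥0∞` and real series. -/
theorem isGammaMixture_gammaMix {w : ℕ → ℝ} {μ K g : ℝ} (hμ : 0 < μ) (hK : 0 ≤ K) (hg : 0 < g)
    (hw0 : ∀ i, 0 ≤ w i) (hw : HasSum w 1) :
    IsGammaMixture (gammaMix (fun k => ENNReal.ofReal (w k)) μ (μ * (K + 1) / g)) w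
      (fun i => μ + i) (fun i => g * (μ + i) / (μ * (K + 1))) := by
  set r := μ * (K + 1) / g with hrdef
  have hr : 0 < r := by positivity
  have hl : ∀ i : ℕ, 0 < μ + i := fun i => by positivity
  have hv : ∀ i : ℕ, 0 < g * (μ + i) / (μ * (K + 1)) := fun i => by positivity
  have hlv : ∀ i : ℕ, (μ + i) / (g * (μ + i) / (μ * (K + 1))) = r := fun i => by
    rw [hrdef]; have := (hl i).ne'; field_simp
  have hw1 : ∀ i, w i ≤ 1 := fun i => le_hasSum hw i fun j _ => hw0 j
  have hpdf : ∀ x : ℝ, 0 < x → ∀ i : ℕ,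
      gammaShapePDF (μ + i) (g * (μ + i) / (μ * (K + 1))) x = gammaPDFReal (μ + i) r x :=
    fun x hx i => by rw [gammaShapePDF_eq_gammaPDFReal (hl i) (hv i) hx, hlv]
  have hsum : ∀ x : ℝ, 0 < x → Summable fun i : ℕ => w i * gammaPDFReal (μ + i) r x :=
    fun x hx => (summable_gammaPDFReal hμ hr hx).of_nonneg_of_le
      (fun i => mul_nonneg (hw0 i) (gammaPDFReal_nonneg (hl i) hr x))
      (fun i => mul_le_of_le_one_left (gammaPDFReal_nonneg (hl i) hr x) (hw1 i))
  refine ⟨hw0, hw, fun x hx => by simpa only [hpdf x hx] using hsum x hx, ?_, fun x hx => ?_⟩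
  · have hm : ∀ a r, Measurable (gammaPDF a r) := fun a r =>
      (measurable_gammaPDFReal a r).ennreal_ofReal
    have : gammaMix (fun k => ENNReal.ofReal (w k)) μ r =
        volume.withDensity (∑' k : ℕ, (fun x => ENNReal.ofReal (w k) * gammaPDF (μ + k) r x)) := by
      rw [withDensity_tsum fun k => (hm _ _).const_mul _, gammaMix]
      congr 1
      funext k
      exact (withDensity_smul _ (hm _ _)).symm
    rw [this]
    refine withDensity_congr_ae ?_
    have h0 : ∀ᵐ x : ℝ, x ≠ 0 := by simp [ae_iff]
    filter_upwards [h0] with x hx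
    rw [ENNReal.tsum_apply]
    rcases lt_or_gt_of_ne hx with hx | hx
    · simp [gammaPDF_of_neg hx, not_lt.2 hx.le]
    · simp only [if_pos hx, hpdf x hx]
      rw [ENNReal.ofReal_tsum_of_nonneg
        (fun i => mul_nonneg (hw0 i) (gammaPDFReal_nonneg (hl i) hr x)) (hsum x hx)]
      refine tsum_congr fun i => ?_
      rw [ENNReal.ofReal_mul (hw0 i), gammaPDF]
  · have hP := fun i : ℕ => isProbabilityMeasure_gammaMeasure (hl i) hr
    have hcdf : ∀ i : ℕ, gammaShapeCDF (μ + i) (g * (μ + i) / (μ * (K + 1))) x =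
        (gammaMeasure (μ + i) r).real (Iic x) := fun i => by
      rw [gammaShapeCDF_eq_real (hl i) (hv i) hx, hlv]
    simp only [hcdf]
    have hs : Summable fun i : ℕ => w i * (gammaMeasure (μ + i) r).real (Iic x) :=
      hw.summable.of_nonneg_of_le (fun i => mul_nonneg (hw0 i) measureReal_nonneg)
        (fun i => mul_le_of_le_one_right (hw0 i) measureReal_le_one)
    convert hs.hasSum using 1
    rw [measureReal_def, gammaMix_apply _ _ _ measurableSet_Iic, ← ENNReal.toReal_ofReal
      (tsum_nonneg fun i => mul_nonneg (hw0 i) measureReal_nonneg),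
      ENNReal.ofReal_tsum_of_nonneg (fun i => mul_nonneg (hw0 i) measureReal_nonneg) hs]
    congr 1
    refine tsum_congr fun i => ?_
    rw [ENNReal.ofReal_mul (hw0 i), ofReal_measureReal]

/-! ### The binomial series under an integral -/

/-- The coefficients `(a)ₙ / n!` of `(1 - x)^(-a)`. -/
def risingCoeff (a : ℝ) (n : ℕ) : ℝ := (ascPochhammer ℝ n).eval a / n.factorial

theorem risingCoeff_nonneg {a : ℝ} (ha : 0 < a) (n : ℕ) : 0 ≤ risingCoeff a n :=
  div_nonneg (ascPochhammer_pos n a ha).le (by positivity)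

theorem hasSum_risingCoeff (a : ℝ) {x : ℝ} (hx : |x| < 1) :
    HasSum (fun n => risingCoeff a n * x ^ n) ((1 - x) ^ (-a)) := by
  have h := (Real.one_div_one_sub_rpow_hasFPowerSeriesOnBall_zero a).hasSum (y := x)
    (by simpa [enorm_eq_nnnorm, ← NNReal.coe_lt_coe] using hx)
  rw [zero_add, one_div, ← Real.rpow_neg (by linarith [(abs_lt.1 hx).2])] at h
  refine h.congr_fun fun n => ?_
  rw [FormalMultilinearSeries.ofScalars_apply_eq, smul_eq_mul]
  congr 1
  -- The coefficient of the library series is `Ring.choose (a + n - 1) n`, which unfolds to a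
  -- multichoose; n! times it is the rising factorial.
  have h2 := Ring.factorial_nsmul_multichoose_eq_ascPochhammer a n
  rw [Ring.choose, show a + n - 1 - n + 1 = a by ring, risingCoeff]
  rw [Polynomial.ascPochhammer_smeval_eq_eval, nsmul_eq_mul] at h2
  rw [← h2]
  field_simp

theorem summable_risingCoeff {a ρ : ℝ} (h0 : 0 ≤ ρ) (h1 : ρ < 1) :
    Summable fun n => risingCoeff a n * ρ ^ n :=
  (hasSum_risingCoeff a (by rwa [abs_of_nonneg h0])).summable

section Integral

variable {α : Type*} [MeasurableSpace α] {Q : Measure α} [IsProbabilityMeasure Q]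

theorem norm_integral_mul_pow_le {f h : α → ℝ} {B C : ℝ} (hf : ∀ x, |f x| ≤ C)
    (hh : ∀ x, |h x| ≤ B) (n : ℕ) : ‖∫ x, f x * h x ^ n ∂Q‖ ≤ C * B ^ n := by
  refine (norm_integral_le_of_norm_le_const (C := C * B ^ n)
    (Filter.Eventually.of_forall fun x => ?_)).trans_eq (by simp)
  rw [norm_mul, norm_pow]
  exact mul_le_mul (hf x) (pow_le_pow_left₀ (abs_nonneg _) (hh x) n) (by positivity)
    ((abs_nonneg _).trans (hf x))

/-- Dominated convergence with the constant majorants C (a)ₙ/n! (|y| B)ⁿ. It serves twice: at the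
origin it produces the Gauss series, and at other centres it gives analyticity. -/
theorem hasSum_integral_mul_one_sub_rpow {a B C y : ℝ} (ha : 0 < a) {f h : α → ℝ}
    (hfm : Measurable f) (hhm : Measurable h) (hf : ∀ x, |f x| ≤ C) (hh : ∀ x, |h x| ≤ B)
    (hy : |y| * B < 1) :
    HasSum (fun n => risingCoeff a n * (∫ x, f x * h x ^ n ∂Q) * y ^ n)
      (∫ x, f x * (1 - y * h x) ^ (-a) ∂Q) := by
  have hB : 0 ≤ B := by
    obtain ⟨x⟩ := Q.nonempty_of_neZero
    exact (abs_nonneg _).trans (hh x)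
  have hyh : ∀ x, |y * h x| ≤ |y| * B := fun x => by
    rw [abs_mul]; exact mul_le_mul_of_nonneg_left (hh x) (abs_nonneg _)
  have key := hasSum_integral_of_dominated_convergence (μ := Q)
    (F := fun n x => f x * (risingCoeff a n * (y * h x) ^ n))
    (f := fun x => f x * (1 - y * h x) ^ (-a))
    (fun n _ => C * (risingCoeff a n * (|y| * B) ^ n))
    (fun n => by fun_prop)
    (fun n => Filter.Eventually.of_forall fun x => by
      rw [norm_mul, norm_mul, norm_pow, Real.norm_of_nonneg (risingCoeff_nonneg ha n)]
      have h1 := pow_le_pow_left₀ (abs_nonneg _) (hyh x) n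
      exact mul_le_mul (hf x) (mul_le_mul_of_nonneg_left h1 (risingCoeff_nonneg ha n))
        (mul_nonneg (risingCoeff_nonneg ha n) (by positivity)) ((abs_nonneg _).trans (hf x)))
    (Filter.Eventually.of_forall fun x =>
      (summable_risingCoeff (by positivity) hy).mul_left C)
    (integrable_const _)
    (Filter.Eventually.of_forall fun x =>
      (hasSum_risingCoeff a ((hyh x).trans_lt hy)).mul_left (f x))
  refine key.congr_fun fun n => ?_
  rw [mul_assoc, mul_comm (∫ x, f x * h x ^ n ∂Q), ← mul_assoc, ← integral_const_mul]
  refine integral_congr_ae (Filter.Eventually.of_forall fun x => ?_)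
  simp only [mul_pow]
  ring

/-- Around a centre z one factors 1 - (z + y)t = (1 - zt)(1 - y h) with h = t/(1 - zt), absorbs the
first factor into f, and applies the binomial expansion in y. -/
theorem analyticOnNhd_integral_mul_one_sub_rpow {a C : ℝ} (ha : 0 < a) {f t : α → ℝ}
    (hfm : Measurable f) (htm : Measurable t) (hf : ∀ x, |f x| ≤ C)
    (ht0 : ∀ x, 0 ≤ t x) (ht1 : ∀ x, t x ≤ 1) :
    AnalyticOnNhd ℝ (fun z => ∫ x, f x * (1 - z * t x) ^ (-a) ∂Q) (Iio 1) := by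
  intro z hz
  obtain ⟨δ, hδ, hzδ⟩ : ∃ δ : ℝ, 0 < δ ∧ ∀ x, δ ≤ 1 - z * t x := by
    refine ⟨1 - max z 0, by simpa using hz, fun x => ?_⟩
    have : z * t x ≤ max z 0 := by
      rcases le_total 0 z with h | h
      · exact (mul_le_of_le_one_right h (ht1 x)).trans (le_max_left _ _)
      · exact (mul_nonpos_of_nonpos_of_nonneg h (ht0 x)).trans (le_max_right _ _)
    linarith
  have hpos : ∀ x, 0 < 1 - z * t x := fun x => hδ.trans_le (hzδ x)
  set f' : α → ℝ := fun x => f x * (1 - z * t x) ^ (-a) with hf'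
  set h : α → ℝ := fun x => t x / (1 - z * t x) with hh
  have hfm' : Measurable f' := by fun_prop
  have hhm : Measurable h := by fun_prop
  have hfb : ∀ x, |f' x| ≤ C * δ ^ (-a) := fun x => by
    rw [hf', abs_mul, abs_of_nonneg (Real.rpow_nonneg (hpos x).le _)]
    exact mul_le_mul (hf x) (Real.rpow_le_rpow_of_nonpos hδ (hzδ x) (by linarith))
      (Real.rpow_nonneg (hpos x).le _) ((abs_nonneg _).trans (hf x))
  have hhb : ∀ x, |h x| ≤ 1 / δ := fun x => by
    rw [hh, abs_of_nonneg (div_nonneg (ht0 x) (hpos x).le)]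
    exact div_le_div₀ zero_le_one (ht1 x) hδ (hzδ x)
  -- As |h| ≤ 1/δ, the expansion converges for |y| < δ; half of this radius leaves the majorant
  -- ratio 1/2.
  let r : NNReal := ⟨δ / 2, by positivity⟩
  have hr : (r : ℝ) = δ / 2 := rfl
  refine ⟨FormalMultilinearSeries.ofScalars ℝ
    (fun n => risingCoeff a n * ∫ x, f' x * h x ^ n ∂Q), r, ?_, ?_, ?_⟩
  · refine FormalMultilinearSeries.le_radius_of_summable _ ?_
    refine ((summable_risingCoeff (a := a) (ρ := 1 / 2) (by norm_num)
      (by norm_num)).mul_left (C * δ ^ (-a))).of_nonneg_of_le (fun n => by positivity)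
      fun n => ?_
    rw [FormalMultilinearSeries.ofScalars_norm, norm_mul,
      Real.norm_of_nonneg (risingCoeff_nonneg ha n), hr]
    have h1 := norm_integral_mul_pow_le (Q := Q) hfb hhb n
    have h2 : (1 / δ) ^ n * (δ / 2) ^ n = (1 / 2) ^ n := by
      rw [← mul_pow]; congr 1; field_simp
    calc risingCoeff a n * ‖∫ x, f' x * h x ^ n ∂Q‖ * (δ / 2) ^ n
        ≤ risingCoeff a n * (C * δ ^ (-a) * (1 / δ) ^ n) * (δ / 2) ^ n := by
          gcongr
          exact risingCoeff_nonneg ha n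
      _ = C * δ ^ (-a) * (risingCoeff a n * ((1 / δ) ^ n * (δ / 2) ^ n)) := by ring
      _ = _ := by rw [h2]
  · simpa [← NNReal.coe_pos, hr] using hδ
  · intro y hy
    have hy' : |y| < δ / 2 := by
      simpa [enorm_eq_nnnorm, ← NNReal.coe_lt_coe, hr] using hy
    have hy1 : |y| * (1 / δ) < 1 := by
      rw [mul_one_div, div_lt_one hδ]; linarith
    have := hasSum_integral_mul_one_sub_rpow (Q := Q) ha hfm' hhm hfb hhb hy1
    simp only [FormalMultilinearSeries.ofScalars_apply_eq, smul_eq_mul]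
    have e : ∫ x, f x * (1 - (z + y) * t x) ^ (-a) ∂Q =
        ∫ x, f' x * (1 - y * h x) ^ (-a) ∂Q := by
      refine integral_congr_ae (Filter.Eventually.of_forall fun x => ?_)
      simp only [hf', hh]
      have h3 : 0 < 1 - y * (t x / (1 - z * t x)) := by
        have : y * h x ≤ |y| * (1 / δ) := (le_abs_self _).trans (by
          rw [abs_mul]; exact mul_le_mul_of_nonneg_left (hhb x) (abs_nonneg _))
        have := this.trans_lt hy1
        simp only [hh] at this
        linarith
      rw [mul_assoc, ← Real.mul_rpow (hpos x).le h3.le]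
      congr 2
      have := (hpos x).ne'
      field_simp
      ring
    rwa [e]

end Integral

/-! ### The uniform phase and its moments -/

instance isProbabilityMeasure_uniformPhase : IsProbabilityMeasure uniformPhase := by
  refine cond_isProbabilityMeasure_of_finite (by simp [Real.pi_pos]) ?_
  rw [Real.volume_Ioo]
  exact ENNReal.ofReal_ne_top

theorem integral_uniformPhase (f : ℝ → ℝ) :
    ∫ θ, f θ ∂uniformPhase = (2 * Real.pi)⁻¹ * ∫ θ in (0 : ℝ)..(2 * Real.pi), f θ := by
  have h : 0 ≤ 2 * Real.pi := by positivity
  rw [uniformPhase, ProbabilityTheory.cond, integral_smul_measure, Real.volume_Ioo, sub_zero,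
    ENNReal.toReal_inv, ENNReal.toReal_ofReal h, intervalIntegral.integral_of_le h,
    integral_Ioc_eq_integral_Ioo, smul_eq_mul]

theorem integral_cos_uniformPhase : ∫ θ, Real.cos θ ∂uniformPhase = 0 := by
  rw [integral_uniformPhase]; simp

/-- `cos² (θ / 2) = (1 + cos θ) / 2`, which for a uniform phase `θ` has the arcsine law. -/
def halfCos (θ : ℝ) : ℝ := (1 + Real.cos θ) / 2

@[fun_prop]
theorem continuous_halfCos : Continuous halfCos := by unfold halfCos; fun_prop

theorem halfCos_nonneg (θ : ℝ) : 0 ≤ halfCos θ := by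
  unfold halfCos; linarith [Real.neg_one_le_cos θ]

theorem halfCos_le_one (θ : ℝ) : halfCos θ ≤ 1 := by
  unfold halfCos; linarith [Real.cos_le_one θ]

/-- Wallis' integral: cos²(θ/2) = sin²(θ/2 + π/2), and the substitution maps (0, 2π) onto one period
of sin²ⁿ, which may be shifted to (0, π). -/
theorem integral_halfCos_pow (n : ℕ) :
    ∫ θ, halfCos θ ^ n ∂uniformPhase =
      Real.Gamma (n + 1 / 2) / (Real.sqrt Real.pi * Real.Gamma (n + 1)) := by
  have h1 : ∫ θ in (0 : ℝ)..(2 * Real.pi), halfCos θ ^ n =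
      2 * ∫ θ in (0 : ℝ)..Real.pi, Real.sin θ ^ (2 * n) := by
    have e : ∀ θ, halfCos θ ^ n = (fun u => Real.sin u ^ (2 * n)) (θ / 2 + Real.pi / 2) := by
      intro θ
      simp only [Real.sin_add_pi_div_two, pow_mul, halfCos]
      rw [Real.cos_sq]
      congr 1
      rw [mul_div_cancel₀ _ (two_ne_zero' ℝ)]
      ring
    rw [intervalIntegral.integral_congr fun θ _ => e θ,
      intervalIntegral.integral_comp_div_add (fun u => Real.sin u ^ (2 * n)) two_ne_zero,
      smul_eq_mul]
    congr 1
    have hper : Function.Periodic (fun u => Real.sin u ^ (2 * n)) Real.pi := fun u => by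
      simp [pow_mul]
    have := hper.intervalIntegral_add_eq (Real.pi / 2) 0
    rw [zero_add] at this
    rw [← this]
    congr 1 <;> ring
  have h2 : ∏ i ∈ Finset.range n, (2 * (i : ℝ) + 1) / (2 * i + 2) =
      Real.Gamma (n + 1 / 2) / (Real.sqrt Real.pi * Real.Gamma (n + 1)) := by
    clear h1
    induction n with
    | zero =>
      have := (Real.sqrt_pos.2 Real.pi_pos).ne'
      simp [Real.Gamma_one_half_eq, -one_div, this]
    | succ k ih =>
      rw [Finset.prod_range_succ, ih]
      push_cast
      rw [Real.Gamma_add_one (s := (k : ℝ) + 1) (by positivity),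
        show (k : ℝ) + 1 + 1 / 2 = (k + 1 / 2) + 1 by ring,
        Real.Gamma_add_one (s := (k : ℝ) + 1 / 2) (by positivity)]
      have h3 : Real.Gamma ((k : ℝ) + 1) ≠ 0 := (Real.Gamma_pos_of_pos (by positivity)).ne'
      have := (Real.sqrt_pos.2 Real.pi_pos).ne'
      field_simp
  rw [integral_uniformPhase, h1, integral_sin_pow_even, h2]
  have := Real.pi_pos.ne'
  field_simp

theorem integral_halfCos_pow_pos (n : ℕ) : 0 < ∫ θ, halfCos θ ^ n ∂uniformPhase := by
  rw [integral_halfCos_pow]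
  have := Real.Gamma_pos_of_pos (show 0 < (n : ℝ) + 1 / 2 by positivity)
  have := Real.Gamma_pos_of_pos (show 0 < (n : ℝ) + 1 by positivity)
  have := Real.sqrt_pos.2 Real.pi_pos
  positivity

theorem integral_halfCos_pow_succ (n : ℕ) :
    ∫ θ, halfCos θ ^ (n + 1) ∂uniformPhase =
      (∫ θ, halfCos θ ^ n ∂uniformPhase) * ((n + 1 / 2) / (n + 1)) := by
  rw [integral_halfCos_pow, integral_halfCos_pow]
  push_cast
  rw [Real.Gamma_add_one (s := (n : ℝ) + 1) (by positivity),
    show (n : ℝ) + 1 + 1 / 2 = (n + 1 / 2) + 1 by ring,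
    Real.Gamma_add_one (s := (n : ℝ) + 1 / 2) (by positivity)]
  have h3 : Real.Gamma ((n : ℝ) + 1) ≠ 0 := (Real.Gamma_pos_of_pos (by positivity)).ne'
  have := (Real.sqrt_pos.2 Real.pi_pos).ne'
  field_simp

/-- The moment ratio (q + 1/2)ₙ / (q + 1)ₙ is the factor by which the Gauss series with b = q + 1/2,
c = q + 1 differs from the binomial series. -/
theorem integral_halfCos_pow_add (q n : ℕ) :
    ∫ θ, halfCos θ ^ (q + n) ∂uniformPhase =
      (∫ θ, halfCos θ ^ q ∂uniformPhase) *
        ((ascPochhammer ℝ n).eval (q + 1 / 2 : ℝ) * ((ascPochhammer ℝ n).eval (q + 1 : ℝ))⁻¹) := by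
  induction n with
  | zero => simp
  | succ k ih =>
    rw [← add_assoc, integral_halfCos_pow_succ, ih, ascPochhammer_succ_eval,
      ascPochhammer_succ_eval]
    have := (ascPochhammer_pos k ((q : ℝ) + 1) (by positivity)).ne'
    push_cast
    have h : (q : ℝ) + 1 + k ≠ 0 := by positivity
    have h' : (q : ℝ) + k + 1 ≠ 0 := by positivity
    field_simp
    ring

/-- Euler's integral for `₂F₁(a, q + 1/2; q + 1; x)`, in trigonometric form. -/
theorem isGaussContinuation_integral_halfCos {a : ℝ} (ha : 0 < a) (q : ℕ) :
    IsGaussContinuation a (q + 1 / 2) (q + 1) fun x =>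
      (∫ θ, halfCos θ ^ q ∂uniformPhase)⁻¹ *
        ∫ θ, halfCos θ ^ q * (1 - x * halfCos θ) ^ (-a) ∂uniformPhase := by
  have hb : ∀ θ, |halfCos θ ^ q| ≤ 1 := fun θ => by
    rw [abs_of_nonneg (pow_nonneg (halfCos_nonneg θ) q)]
    exact pow_le_one₀ (halfCos_nonneg θ) (halfCos_le_one θ)
  have hb' : ∀ θ, |halfCos θ| ≤ 1 := fun θ => by
    rw [abs_of_nonneg (halfCos_nonneg θ)]; exact halfCos_le_one θ
  refine ⟨fun x hx => analyticAt_const.mul (analyticOnNhd_integral_mul_one_sub_rpow ha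
    (by fun_prop) (by fun_prop) hb halfCos_nonneg halfCos_le_one x hx), fun x hx => ?_⟩
  have h := (hasSum_integral_mul_one_sub_rpow (Q := uniformPhase) ha (f := fun θ => halfCos θ ^ q)
    (h := halfCos) (by fun_prop) (by fun_prop) hb hb' (by simpa using hx)).mul_left
    (∫ θ, halfCos θ ^ q ∂uniformPhase)⁻¹
  beta_reduce
  rw [ordinaryHypergeometric_eq_tsum, ← h.tsum_eq]
  refine tsum_congr fun n => ?_
  simp_rw [← pow_add]
  rw [integral_halfCos_pow_add, smul_eq_mul, risingCoeff]
  have := (integral_halfCos_pow_pos q).ne'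
  field_simp

/-- The Gamma ratio is √π times the q-th moment of `halfCos`, so it cancels the normalisation of
Euler's integral. -/
theorem gamma_ratio_mul_gaussHyp {a x : ℝ} (ha : 0 < a) (hx : x < 1) (q : ℕ) :
    Real.Gamma (q + 1 / 2) / Real.Gamma (q + 1) * gaussHyp a (q + 1 / 2) (q + 1) x =
      Real.sqrt Real.pi * ∫ θ, halfCos θ ^ q * (1 - x * halfCos θ) ^ (-a) ∂uniformPhase := by
  rw [gaussHyp_eq (isGaussContinuation_integral_halfCos ha q) hx, integral_halfCos_pow]
  have h1 := (Real.Gamma_pos_of_pos (show 0 < (q : ℝ) + 1 / 2 by positivity)).ne'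
  have h2 := (Real.Gamma_pos_of_pos (show 0 < (q : ℝ) + 1 by positivity)).ne'
  have := (Real.sqrt_pos.2 Real.pi_pos).ne'
  generalize Real.Gamma (q + 1 / 2) = A at *
  generalize Real.Gamma (q + 1) = B at *
  field_simp

/-! ### The weights as averaged Poisson probabilities -/

theorem integrable_uniformPhase {f : ℝ → ℝ} (hf : Continuous f) : Integrable f uniformPhase := by
  have h : IntegrableOn f (Ioo 0 (2 * Real.pi)) :=
    (hf.integrableOn_Icc (a := 0) (b := 2 * Real.pi)).mono_set Ioo_subset_Icc_self
  rw [uniformPhase, ProbabilityTheory.cond]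
  refine Integrable.smul_measure h ?_
  simp [Real.pi_pos]

theorem lintegral_uniformPhase {f : ℝ → ℝ} (hf : Continuous f) (h0 : ∀ θ, 0 ≤ f θ) :
    ∫⁻ θ, ENNReal.ofReal (f θ) ∂uniformPhase = ENNReal.ofReal (∫ θ, f θ ∂uniformPhase) :=
  (ofReal_integral_eq_lintegral_ofReal (integrable_uniformPhase hf)
    (Filter.Eventually.of_forall h0)).symm

/-- With t = `halfCos θ`, the intensity is μK((1 - Δ) + 2Δt), and adding m gives D(1 - zt), where z
≤ 0 is the hypergeometric argument. Expanding the i-th power binomially recovers the sum over q.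
Since D ≥ m > 0, the case Δ = 1 needs no separate treatment. -/
theorem weight_eq_integral {K m μ Δ : ℝ} (hK : 0 ≤ K) (hm : 0 < m) (hμ : 0 < μ) (hΔ0 : 0 ≤ Δ)
    (hΔ1 : Δ ≤ 1) (i : ℕ) :
    weight K m μ Δ i = ∫ θ, Real.Gamma (m + i) * m ^ m / (Real.Gamma m * Real.Gamma (i + 1)) *
      ((μ * K * (1 + Δ * Real.cos θ)) ^ i /
        (μ * K * (1 + Δ * Real.cos θ) + m) ^ (m + i)) ∂uniformPhase := by
  have hD : 0 < μ * K * (1 - Δ) + m := by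
    have : 0 ≤ 1 - Δ := by linarith
    positivity
  set D := μ * K * (1 - Δ) + m with hDdef
  set z := -(2 * μ * K * Δ) / D with hz
  have hz0 : z ≤ 0 := by
    rw [hz, neg_div, neg_nonpos]; positivity
  have ha : 0 < m + i := by positivity
  have hzt : ∀ θ, 0 < 1 - z * halfCos θ := fun θ => by
    have := mul_nonpos_of_nonpos_of_nonneg hz0 (halfCos_nonneg θ)
    linarith
  have hcont : ∀ q : ℕ, Continuous fun θ => halfCos θ ^ q * (1 - z * halfCos θ) ^ (-(m + i)) :=
    fun q => (by fun_prop : Continuous fun θ => halfCos θ ^ q).mul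
      (Continuous.rpow_const (by fun_prop) fun θ => Or.inl (hzt θ).ne')
  have hterm : ∀ q : ℕ, (i.choose q : ℝ) * (Real.Gamma (q + 1 / 2) / Real.Gamma (q + 1)) *
      ((1 - Δ) ^ (i - q) * (2 * Δ) ^ q) * gaussHyp (m + i) (q + 1 / 2) (q + 1) z =
      Real.sqrt Real.pi * ∫ θ, (i.choose q : ℝ) * ((1 - Δ) ^ (i - q) * (2 * Δ) ^ q) *
        (halfCos θ ^ q * (1 - z * halfCos θ) ^ (-(m + i))) ∂uniformPhase := fun q => by
    rw [integral_const_mul, mul_left_comm (Real.sqrt Real.pi),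
      ← gamma_ratio_mul_gaussHyp ha (by linarith) q]
    ring
  rw [weight, Finset.sum_congr rfl fun q _ => hterm q, ← Finset.mul_sum,
    ← integral_finsetSum _ fun q _ => (integrable_uniformPhase (hcont q)).const_mul _,
    ← mul_assoc, ← integral_const_mul]
  refine integral_congr_ae (Filter.Eventually.of_forall fun θ => ?_)
  beta_reduce
  have hs : μ * K * (1 + Δ * Real.cos θ) = μ * K * (2 * Δ * halfCos θ + (1 - Δ)) := by
    rw [halfCos]; ring
  have hs' : μ * K * (1 + Δ * Real.cos θ) + m = D * (1 - z * halfCos θ) := by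
    rw [hs, hz, mul_sub, ← mul_assoc, mul_div_cancel₀ _ hD.ne', hDdef]; ring
  rw [← hDdef, hs', hs, mul_pow (μ * K) (2 * Δ * _ + _), add_pow,
    Real.mul_rpow hD.le (hzt θ).le, Real.rpow_neg (hzt θ).le]
  have h1 := (Real.rpow_pos_of_pos hD (m + i)).ne'
  have h2 := (Real.rpow_pos_of_pos (hzt θ) (m + i)).ne'
  have h3 : ∑ q ∈ Finset.range (i + 1), (i.choose q : ℝ) * ((1 - Δ) ^ (i - q) * (2 * Δ) ^ q) *
        (halfCos θ ^ q * ((1 - z * halfCos θ) ^ (m + (i : ℝ)))⁻¹) =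
      (∑ q ∈ Finset.range (i + 1), (2 * Δ * halfCos θ) ^ q * (1 - Δ) ^ (i - q) * (i.choose q : ℝ)) *
        ((1 - z * halfCos θ) ^ (m + (i : ℝ)))⁻¹ := by
    rw [Finset.sum_mul]
    refine Finset.sum_congr rfl fun q _ => ?_
    rw [mul_pow (2 * Δ)]
    ring
  rw [h3]
  field_simp

theorem intensity_nonneg {K μ Δ : ℝ} (hK : 0 ≤ K) (hμ : 0 < μ) (hΔ0 : 0 ≤ Δ)
    (hΔ1 : Δ ≤ 1) (θ : ℝ) : 0 ≤ μ * K * (1 + Δ * Real.cos θ) := by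
  have : 0 ≤ 1 + Δ * Real.cos θ := by nlinarith [Real.neg_one_le_cos θ]
  positivity

theorem weight_nonneg {K m μ Δ : ℝ} (hK : 0 ≤ K) (hm : 0 < m) (hμ : 0 < μ) (hΔ0 : 0 ≤ Δ)
    (hΔ1 : Δ ≤ 1) (i : ℕ) : 0 ≤ weight K m μ Δ i := by
  rw [weight_eq_integral hK hm hμ hΔ0 hΔ1]
  refine integral_nonneg fun θ => ?_
  have := intensity_nonneg hK hμ hΔ0 hΔ1 θ
  have := (Real.Gamma_pos_of_pos hm).le
  have : 0 ≤ Real.Gamma (m + i) := (Real.Gamma_pos_of_pos (by positivity)).le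
  have : 0 ≤ Real.Gamma ((i : ℝ) + 1) := (Real.Gamma_pos_of_pos (by positivity)).le
  simp only [Pi.zero_apply]
  positivity

/-- Tonelli with the fluctuation integrated first: the inner integral is negative binomial, the
outer one is that of `weight_eq_integral`. Later averages use the weights in this form. -/
theorem ofReal_weight {K m μ Δ : ℝ} (hK : 0 ≤ K) (hm : 0 < m) (hμ : 0 < μ) (hΔ0 : 0 ≤ Δ)
    (hΔ1 : Δ ≤ 1) (i : ℕ) :
    ENNReal.ofReal (weight K m μ Δ i) =
      ∫⁻ a, ENNReal.ofReal (poissonWeight (a.1 * (μ * K * (1 + Δ * Real.cos a.2))) i)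
        ∂(gammaMeasure m m).prod uniformPhase := by
  have := isProbabilityMeasure_gammaMeasure hm hm
  have hs := intensity_nonneg hK hμ hΔ0 hΔ1
  rw [lintegral_prod_symm _ (by fun_prop)]
  simp_rw [lintegral_poissonWeight_gammaMeasure hm (hs _) i]
  rw [weight_eq_integral hK hm hμ hΔ0 hΔ1, lintegral_uniformPhase]
  · refine continuous_const.mul (Continuous.div (by fun_prop) ?_ fun θ => ?_)
    · exact Continuous.rpow_const (by fun_prop) fun θ => Or.inl
        (add_pos_of_nonneg_of_pos (hs θ) hm).ne'
    · exact (Real.rpow_pos_of_pos (add_pos_of_nonneg_of_pos (hs θ) hm) _).ne'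
  · intro θ
    have := hs θ
    have := (Real.Gamma_pos_of_pos hm).le
    have : 0 ≤ Real.Gamma (m + i) := (Real.Gamma_pos_of_pos (by positivity)).le
    have : 0 ≤ Real.Gamma ((i : ℝ) + 1) := (Real.Gamma_pos_of_pos (by positivity)).le
    positivity

theorem ae_gammaMeasure_pos (a r : ℝ) : ∀ᵐ z ∂gammaMeasure a r, 0 < z := by
  have hm : Measurable (gammaPDF a r) := (measurable_gammaPDFReal a r).ennreal_ofReal
  rw [gammaMeasure, ae_withDensity_iff hm]
  have h0 : ∀ᵐ x : ℝ, x ≠ 0 := by simp [ae_iff]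
  filter_upwards [h0] with x hx hx'
  by_contra h
  exact hx' (gammaPDF_of_neg (lt_of_le_of_ne (not_lt.1 h) hx))

theorem ae_prod_fst_pos {m : ℝ} (hm : 0 < m) :
    ∀ᵐ a ∂(gammaMeasure m m).prod uniformPhase, 0 < a.1 := by
  have := isProbabilityMeasure_gammaMeasure hm hm
  exact Measure.quasiMeasurePreserving_fst.ae (ae_gammaMeasure_pos m m)

theorem tsum_ofReal_weight {K m μ Δ : ℝ} (hK : 0 ≤ K) (hm : 0 < m) (hμ : 0 < μ) (hΔ0 : 0 ≤ Δ)
    (hΔ1 : Δ ≤ 1) : ∑' i, ENNReal.ofReal (weight K m μ Δ i) = 1 := by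
  have := isProbabilityMeasure_gammaMeasure hm hm
  simp_rw [ofReal_weight hK hm hμ hΔ0 hΔ1]
  rw [← lintegral_tsum fun i => by fun_prop]
  have : ∀ᵐ a ∂(gammaMeasure m m).prod uniformPhase,
      ∑' i, ENNReal.ofReal (poissonWeight (a.1 * (μ * K * (1 + Δ * Real.cos a.2))) i) = 1 := by
    filter_upwards [ae_prod_fst_pos hm] with a ha
    have hs := mul_nonneg ha.le (intensity_nonneg hK hμ hΔ0 hΔ1 a.2)
    rw [← ENNReal.ofReal_tsum_of_nonneg (poissonWeight_nonneg hs)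
      (hasSum_poissonWeight _).summable, (hasSum_poissonWeight _).tsum_eq, ENNReal.ofReal_one]
  rw [lintegral_congr_ae this]
  simp

theorem hasSum_weight {K m μ Δ : ℝ} (hK : 0 ≤ K) (hm : 0 < m) (hμ : 0 < μ) (hΔ0 : 0 ≤ Δ)
    (hΔ1 : Δ ≤ 1) : HasSum (weight K m μ Δ) 1 := by
  have h0 := weight_nonneg hK hm hμ hΔ0 hΔ1
  have h1 := tsum_ofReal_weight hK hm hμ hΔ0 hΔ1
  have hs : Summable (weight K m μ Δ) := by
    have := ENNReal.summable_toReal (f := fun i => ENNReal.ofReal (weight K m μ Δ i))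
      (by rw [h1]; exact ENNReal.one_ne_top)
    simpa only [ENNReal.toReal_ofReal (h0 _)] using this
  rw [← ENNReal.ofReal_tsum_of_nonneg h0 hs, ENNReal.ofReal_eq_one] at h1
  exact h1 ▸ hs.hasSum

/-! ### The law for a real number of clusters -/

/-- For d > 0 the k-th term is the k-th Bessel term times the prefactor, once the half-integer
multiples of μ - 1 in the exponents of x and d are collected. For d = 0 only k = 0 survives, by 0⁰ =
1. -/
theorem hasSum_kappaMuPDF {μ p d x : ℝ} (hμ : 0 < μ) (hp : 0 < p) (hd : 0 ≤ d) (hx : 0 < x) :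
    HasSum (fun k : ℕ => poissonWeight (d / p) k * gammaPDFReal (μ + k) (1 / p) x)
      (kappaMuPDF μ p d x) := by
  have hterm : ∀ k : ℕ, poissonWeight (d / p) k * gammaPDFReal (μ + k) (1 / p) x =
      Real.exp (-(x + d) / p) * ((d / p) ^ k / k.factorial *
        (x ^ (μ - 1) * x ^ k / (Real.Gamma (μ + k) * (p ^ μ * p ^ k)))) := fun k => by
    rw [poissonWeight, gammaPDFReal, if_pos hx.le, Real.div_rpow zero_le_one hp.le, Real.one_rpow,
      Real.rpow_add hp, Real.rpow_natCast, show μ + (k : ℝ) - 1 = μ - 1 + k by ring,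
      Real.rpow_add hx, Real.rpow_natCast, show -(x + d) / p = -(d / p) + -(1 / p * x) by ring,
      Real.exp_add]
    have := (Real.Gamma_pos_of_pos (show 0 < μ + k by positivity)).ne'
    field_simp
  have hsum : Summable fun k : ℕ => poissonWeight (d / p) k * gammaPDFReal (μ + k) (1 / p) x := by
    have hp' : 0 < 1 / p := by positivity
    refine (summable_gammaPDFReal hμ hp' hx).of_nonneg_of_le
      (fun k => mul_nonneg (poissonWeight_nonneg (by positivity) k)
        (gammaPDFReal_nonneg (by positivity) hp' x))
      (fun k => mul_le_of_le_one_left (gammaPDFReal_nonneg (by positivity) hp' x) ?_)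
    exact le_hasSum (hasSum_poissonWeight (d / p)) k
      fun j _ => poissonWeight_nonneg (by positivity) j
  rcases hd.eq_or_lt with rfl | hd
  · have h := hasSum_single (f := fun k : ℕ => poissonWeight (0 / p) k *
      gammaPDFReal (μ + k) (1 / p) x) 0 fun k hk => by simp [poissonWeight, hk]
    convert h using 1
    rw [hterm, kappaMuPDF, if_neg (lt_irrefl 0)]
    simp
    ring
  · convert hsum.hasSum using 1
    rw [kappaMuPDF, if_pos hd, besselI, ← tsum_mul_left]
    refine tsum_congr fun k => ?_
    rw [hterm]
    have hdx : 0 < d * x := by positivity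
    have e1 : 2 * Real.sqrt (d * x) / p / 2 = Real.sqrt (d * x) / p := by ring
    have e2 : (Real.sqrt (d * x) / p) ^ (2 * (k : ℝ) + (μ - 1)) =
        (d * x) ^ k / p ^ (2 * k) * ((d ^ ((μ - 1) / 2) * x ^ ((μ - 1) / 2)) / (p ^ μ / p)) := by
      rw [Real.div_rpow (Real.sqrt_nonneg _) hp.le, Real.sqrt_eq_rpow, ← Real.rpow_mul hdx.le,
        show 1 / 2 * (2 * (k : ℝ) + (μ - 1)) = k + (μ - 1) / 2 by ring, Real.rpow_add hdx,
        Real.rpow_natCast, Real.mul_rpow hd.le hx.le, Real.rpow_add hp,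
        show (2 * (k : ℝ)) = ((2 * k : ℕ) : ℝ) by push_cast; ring, Real.rpow_natCast,
        Real.rpow_sub_one hp.ne']
      ring
    have e3 : x ^ (μ - 1) = x ^ ((μ - 1) / 2) * x ^ ((μ - 1) / 2) := by
      rw [← Real.rpow_add hx]; congr 1; ring
    rw [e1, e2, e3, two_mul k, pow_add, div_pow, mul_pow, Real.div_rpow hx.le hd.le,
      show (k : ℝ) + (μ - 1) + 1 = μ + k by ring]
    have := (Real.Gamma_pos_of_pos (show 0 < μ + k by positivity)).ne'
    have := (Real.rpow_pos_of_pos hd ((μ - 1) / 2)).ne'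
    have := (Real.rpow_pos_of_pos hp μ).ne'
    field_simp

/-- The Poisson parameter d/p = z μK(1 + Δ cos θ) carries all the randomness, while the rate 1/p is
fixed; Tonelli then averages the weights. -/
theorem mftrLaw_eq_gammaMix {K m μ Δ g : ℝ} (hK : 0 ≤ K) (hm : 0 < m) (hμ : 0 < μ)
    (hΔ0 : 0 ≤ Δ) (hΔ1 : Δ ≤ 1) (hg : 0 < g) :
    mftrLaw K m μ Δ g =
      gammaMix (fun k => ENNReal.ofReal (weight K m μ Δ k)) μ (μ * (K + 1) / g) := by
  have := isProbabilityMeasure_gammaMeasure hm hm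
  have hm' : ∀ a r, Measurable (gammaPDF a r) := fun a r =>
    (measurable_gammaPDFReal a r).ennreal_ofReal
  set p := g / (μ * (1 + K)) with hp
  have hp0 : 0 < p := by positivity
  have hr : μ * (K + 1) / g = 1 / p := by rw [hp]; field_simp; ring
  have : gammaMix (fun k => ENNReal.ofReal (weight K m μ Δ k)) μ (μ * (K + 1) / g) =
      volume.withDensity (∑' k : ℕ,
        (fun x => ENNReal.ofReal (weight K m μ Δ k) * gammaPDF (μ + k) (1 / p) x)) := by
    rw [withDensity_tsum fun k => (hm' _ _).const_mul _, gammaMix, hr]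
    congr 1
    funext k
    exact (withDensity_smul _ (hm' _ _)).symm
  rw [this, mftrLaw]
  refine withDensity_congr_ae ?_
  have h0 : ∀ᵐ x : ℝ, x ≠ 0 := by simp [ae_iff]
  filter_upwards [h0] with x hx
  rw [ENNReal.tsum_apply]
  rcases lt_or_gt_of_ne hx with hx | hx
  · simp [gammaPDF_of_neg hx, not_lt.2 hx.le]
  simp only [if_pos hx]
  have hae : ∀ᵐ a ∂(gammaMeasure m m).prod uniformPhase,
      ENNReal.ofReal (kappaMuPDF μ p (a.1 * p * (μ * K * (1 + Δ * Real.cos a.2))) x) =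
      ∑' k : ℕ, ENNReal.ofReal (poissonWeight (a.1 * (μ * K * (1 + Δ * Real.cos a.2))) k) *
        gammaPDF (μ + k) (1 / p) x := by
    filter_upwards [ae_prod_fst_pos hm] with a ha
    have hs := intensity_nonneg hK hμ hΔ0 hΔ1 a.2
    have h := hasSum_kappaMuPDF hμ hp0
      (show 0 ≤ a.1 * p * (μ * K * (1 + Δ * Real.cos a.2)) by positivity) hx
    have e : a.1 * p * (μ * K * (1 + Δ * Real.cos a.2)) / p =
        a.1 * (μ * K * (1 + Δ * Real.cos a.2)) := by field_simp
    rw [e] at h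
    have hpw := fun k => poissonWeight_nonneg (mul_nonneg ha.le hs) k
    rw [← h.tsum_eq, ENNReal.ofReal_tsum_of_nonneg (fun k => mul_nonneg (hpw k)
      (gammaPDFReal_nonneg (by positivity) (by positivity) x)) h.summable]
    exact tsum_congr fun k => ENNReal.ofReal_mul (hpw k)
  rw [lintegral_congr_ae hae, lintegral_tsum fun k => by fun_prop]
  refine tsum_congr fun k => ?_
  rw [lintegral_mul_const _ (by fun_prop), ofReal_weight hK hm hμ hΔ0 hΔ1]

/-! ### Laws determined by their moment generating function near the origin -/

/-- Both moment generating functions extend analytically to the strip |Re z| < ρ. Equality on a real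
interval propagates to the imaginary axis, where they are the characteristic functions. -/
theorem measure_ext_of_mgf_eq_near_zero {ν ν' : Measure ℝ} [IsProbabilityMeasure ν]
    [IsProbabilityMeasure ν'] {ρ : ℝ} (hρ : 0 < ρ)
    (hpos : ∀ t, |t| < ρ → 0 < mgf id ν t)
    (h : ∀ t, |t| < ρ → mgf id ν t = mgf id ν' t) : ν = ν' := by
  -- A positive `mgf` certifies integrability, since a divergent integral has the default value 0.
  have hsub : ∀ κ : Measure ℝ, IsProbabilityMeasure κ → (∀ t, |t| < ρ → 0 < mgf id κ t) →
      Ioo (-ρ) ρ ⊆ interior (integrableExpSet id κ) := fun κ _ hκ =>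
    interior_maximal (fun t ht => mgf_pos_iff.1 (hκ t (abs_lt.2 ht))) isOpen_Ioo
  have h1 := hsub ν inferInstance hpos
  have h2 := hsub ν' inferInstance fun t ht => h t ht ▸ hpos t ht
  have hconv : IsPreconnected {z : ℂ | z.re ∈ Ioo (-ρ) ρ} :=
    ((convex_Ioo (-ρ) ρ).linear_preimage Complex.reLm).isPreconnected
  have hEq : EqOn (complexMGF id ν) (complexMGF id ν') {z : ℂ | z.re ∈ Ioo (-ρ) ρ} := by
    refine AnalyticOnNhd.eqOn_of_preconnected_of_frequently_eq
      (analyticOnNhd_complexMGF.mono fun z hz => h1 hz)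
      (analyticOnNhd_complexMGF.mono fun z hz => h2 hz) hconv (z₀ := 0) (by simpa using hρ) ?_
    have hev : ∀ᶠ x : ℝ in nhdsWithin 0 {0}ᶜ,
        complexMGF id ν (x : ℂ) = complexMGF id ν' (x : ℂ) := by
      refine nhdsWithin_le_nhds ?_
      filter_upwards [Ioo_mem_nhds (neg_lt_zero.2 hρ) hρ] with x hx
      rw [complexMGF_ofReal, complexMGF_ofReal, h x (abs_lt.2 hx)]
    have ht : Filter.Tendsto (fun x : ℝ => (x : ℂ)) (nhdsWithin 0 {0}ᶜ) (nhdsWithin 0 {0}ᶜ) := by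
      refine tendsto_nhdsWithin_iff.2 ⟨?_, ?_⟩
      · have := (Complex.continuous_ofReal.tendsto 0).mono_left
          (nhdsWithin_le_nhds (s := ({0}ᶜ : Set ℝ)))
        simpa using this
      · filter_upwards [self_mem_nhdsWithin] with x hx
        simpa using hx
    exact ht.frequently hev.frequently
  refine Measure.ext_of_charFun (funext fun t => ?_)
  rw [← complexMGF_id_mul_I, ← complexMGF_id_mul_I]
  exact hEq (by simpa using hρ)

theorem mgf_id_gammaMix_poissonWeight {μ r s t : ℝ} (hμ : 0 < μ) (hr : 0 < r) (hs : 0 ≤ s)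
    (ht : t < r) :
    mgf id (gammaMix (fun k => ENNReal.ofReal (poissonWeight s k)) μ r) t =
      (r / (r - t)) ^ μ * Real.exp (s * (r / (r - t) - 1)) := by
  have hq : 0 < r / (r - t) := div_pos hr (sub_pos.2 ht)
  rw [mgf, integral_eq_lintegral_of_nonneg_ae
    (Filter.Eventually.of_forall fun x => (Real.exp_pos _).le) (by fun_prop), lintegral_gammaMix]
  simp only [id]
  have h := (hasSum_poissonWeight_mul_pow s (r / (r - t))).mul_left ((r / (r - t)) ^ μ)
  have h0 : ∀ k, 0 ≤ (r / (r - t)) ^ μ * (poissonWeight s k * (r / (r - t)) ^ k) := fun k =>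
    mul_nonneg (Real.rpow_nonneg hq.le _) (mul_nonneg (poissonWeight_nonneg hs k) (by positivity))
  rw [← h.tsum_eq, ← ENNReal.toReal_ofReal (tsum_nonneg h0),
    ENNReal.ofReal_tsum_of_nonneg h0 h.summable]
  congr 1
  refine tsum_congr fun k => ?_
  rw [lintegral_exp_mul_gammaMeasure (by positivity) hr ht,
    ← ENNReal.ofReal_mul (poissonWeight_nonneg hs k), Real.rpow_add hq, Real.rpow_natCast]
  congr 1
  ring

/-- Completing the square: with w = 1 - 2bv, the tilted density is a constant times the Gaussian
density of mean 2bav/w and variance v/w. -/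
theorem integral_exp_mul_sq_gaussianReal {v : NNReal} (hv : v ≠ 0) {b a : ℝ}
    (hb : 2 * b * v < 1) :
    ∫ x, Real.exp (b * (a + x) ^ 2) ∂gaussianReal 0 v =
      (1 / (1 - 2 * b * v)) ^ (1 / 2 : ℝ) * Real.exp (b * a ^ 2 * (1 / (1 - 2 * b * v))) := by
  have hw : 0 < 1 - 2 * b * v := sub_pos.2 hb
  have hv0 : (0 : ℝ) < v := by positivity
  obtain ⟨w, hwdef⟩ : ∃ w, w = 1 - 2 * b * (v : ℝ) := ⟨_, rfl⟩
  rw [← hwdef] at hw ⊢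
  let v' : NNReal := ⟨v / w, by positivity⟩
  have hv' : (v' : ℝ) = v / w := rfl
  have hv'0 : v' ≠ 0 := by
    rw [← NNReal.coe_ne_zero, hv']; positivity
  rw [integral_gaussianReal_eq_integral_smul hv]
  have key : ∀ x, gaussianPDFReal 0 v x • Real.exp (b * (a + x) ^ 2) =
      (1 / w) ^ (1 / 2 : ℝ) * Real.exp (b * a ^ 2 * (1 / w)) *
        gaussianPDFReal (2 * b * a * (v / w)) v' x := fun x => by
    rw [gaussianPDFReal, gaussianPDFReal, hv', smul_eq_mul, ← Real.sqrt_eq_rpow]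
    have e1 : (Real.sqrt (2 * Real.pi * (v / w)))⁻¹ =
        Real.sqrt w * (Real.sqrt (2 * Real.pi * v))⁻¹ := by
      rw [← mul_div_assoc, Real.sqrt_div (by positivity), inv_div]
      rfl
    have e2 : Real.sqrt (1 / w) * Real.sqrt w = 1 := by
      rw [← Real.sqrt_mul (by positivity), one_div_mul_cancel hw.ne', Real.sqrt_one]
    have e3 : -(x - 0) ^ 2 / (2 * v) + b * (a + x) ^ 2 = b * a ^ 2 * (1 / w) +
        -(x - 2 * b * a * (v / w)) ^ 2 / (2 * (v / w)) := by
      have hb' : b = (1 - w) / (2 * v) := by rw [hwdef]; field_simp; ring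
      rw [hb']
      have := hw.ne'
      have := hv0.ne'
      field_simp
      ring
    rw [e1, mul_assoc, ← Real.exp_add, e3, Real.exp_add]
    linear_combination (-(Real.sqrt (2 * Real.pi * v))⁻¹ * Real.exp (b * a ^ 2 * (1 / w)) *
      Real.exp (-(x - 2 * b * a * (v / w)) ^ 2 / (2 * (v / w)))) * e2
  simp_rw [key]
  rw [integral_const_mul, integral_gaussianPDFReal_eq_one _ hv'0, mul_one]

/-! ### Quadratic forms of independent Gaussian variables -/

section Gaussian

variable {Ω J : Type*} [MeasurableSpace Ω] {P : Measure Ω} [IsProbabilityMeasure P] [Fintype J]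
  {v : NNReal} {c : ℝ} {W : J → Ω → ℝ}

/-- The noncentral chi-square law as a Poisson mixture of Gamma laws. -/
theorem map_sum_add_sq_eq_gammaMix [Nonempty J] (hv : v ≠ 0) (hc : 0 < c) (hW : iIndepFun W P)
    (hlaw : ∀ j, HasLaw (W j) (gaussianReal 0 v) P) (a : J → ℝ) :
    P.map (fun ω => c * ∑ j, (a j + W j ω) ^ 2) =
      gammaMix (fun k => ENNReal.ofReal (poissonWeight ((∑ j, a j ^ 2) / (2 * v)) k))
        (Fintype.card J / 2) (1 / (2 * c * v)) := by
  have hv0 : (0 : ℝ) < v := by positivity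
  have hr : 0 < 1 / (2 * c * v) := by positivity
  have hJ : 0 < (Fintype.card J : ℝ) / 2 := by
    have : 0 < Fintype.card J := Fintype.card_pos
    positivity
  have hs : 0 ≤ (∑ j, a j ^ 2) / (2 * v) := by positivity
  have hm : ∀ j, AEMeasurable (fun ω => c * (a j + W j ω) ^ 2) P := fun j => by
    have := (hlaw j).aemeasurable
    fun_prop
  have hsum : (fun ω => c * ∑ j, (a j + W j ω) ^ 2) =
      ∑ j, fun ω => c * (a j + W j ω) ^ 2 := by
    funext ω; simp [Finset.mul_sum]
  have hmS : AEMeasurable (fun ω => c * ∑ j, (a j + W j ω) ^ 2) P := by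
    rw [hsum]; exact Finset.aemeasurable_sum _ fun j _ => hm j
  have h1 : IsProbabilityMeasure (P.map fun ω => c * ∑ j, (a j + W j ω) ^ 2) :=
    Measure.isProbabilityMeasure_map hmS
  have h2 := isProbabilityMeasure_gammaMix
    (w := fun k => ENNReal.ofReal (poissonWeight ((∑ j, a j ^ 2) / (2 * v)) k)) hJ hr (by
      rw [← ENNReal.ofReal_tsum_of_nonneg (poissonWeight_nonneg hs)
        (hasSum_poissonWeight _).summable, (hasSum_poissonWeight _).tsum_eq, ENNReal.ofReal_one])
  -- The mixture comes first because positivity is asked of the first measure only, and its moment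
  -- generating function is explicit.
  symm
  have hmgf := fun t (ht : t < 1 / (2 * c * v)) => mgf_id_gammaMix_poissonWeight hJ hr hs ht
  refine measure_ext_of_mgf_eq_near_zero hr (fun t ht => ?_) fun t ht => ?_
  · have ht' := (le_abs_self t).trans_lt ht
    rw [hmgf t ht']
    have := div_pos hr (sub_pos.2 ht')
    positivity
  · have ht' := (le_abs_self t).trans_lt ht
    have htb : 2 * (t * c) * v < 1 := by
      rw [lt_div_iff₀ (by positivity)] at ht'
      linarith
    have hw : 0 < 1 - 2 * (t * c) * v := sub_pos.2 htb
    -- The Gamma ratio r/(r - t) at r = 1/(2cv) is the factor 1/w of one tilted Gaussian; the power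
    -- 1/2 from each coordinate adds up to the shape `card J / 2`.
    have hq : 1 / (2 * c * v) / (1 / (2 * c * v) - t) = 1 / (1 - 2 * (t * c) * v) := by
      rw [div_sub' (by positivity), div_div_div_cancel_right₀ (by positivity)]
      congr 1
      ring
    rw [hmgf t ht', hq, mgf_id_map hmS, hsum, iIndepFun.mgf_sum₀ ?_ hm]
    · have hj : ∀ j, mgf (fun ω => c * (a j + W j ω) ^ 2) P t =
          (1 / (1 - 2 * (t * c) * v)) ^ (1 / 2 : ℝ) *
            Real.exp (t * c * a j ^ 2 * (1 / (1 - 2 * (t * c) * v))) := fun j => by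
        rw [← integral_exp_mul_sq_gaussianReal hv htb, ← (hlaw j).map_eq,
          integral_map (hlaw j).aemeasurable (by fun_prop), mgf]
        simp only [mul_assoc]
      rw [Finset.prod_congr rfl fun j _ => hj j, Finset.prod_mul_distrib, Finset.prod_const,
        ← Real.exp_sum, Finset.card_univ, ← Real.rpow_natCast, ← Real.rpow_mul (by positivity),
        ← Finset.sum_mul, ← Finset.mul_sum]
      -- Here 1 - w = 2tcv, which cancels the 2v in the Poisson parameter and matches the exponents.
      have e : ∀ w : ℝ, w ≠ 0 → 1 / w - 1 = (1 - w) * (1 / w) := fun w hw => by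
        field_simp
      congr 2
      · ring
      · rw [e _ hw.ne', sub_sub_cancel]
        field_simp
    · exact hW.comp (fun j x => c * (a j + x) ^ 2) fun j => by fun_prop

/-- A noncentral chi-square law whose means are an independent random vector. -/
theorem map_sum_add_sq_eq_gammaMix_of_indepFun [Nonempty J] {E : Type*} [MeasurableSpace E]
    (hv : v ≠ 0) (hc : 0 < c) (hW : iIndepFun W P)
    (hlaw : ∀ j, HasLaw (W j) (gaussianReal 0 v) P) {Θ : Ω → E} (hΘ : AEMeasurable Θ P)
    (hind : IndepFun Θ (fun ω j => W j ω) P) {A : E → J → ℝ} (hA : Measurable A) :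
    P.map (fun ω => c * ∑ j, (A (Θ ω) j + W j ω) ^ 2) =
      gammaMix (fun k => ∫⁻ ω, ENNReal.ofReal
        (poissonWeight ((∑ j, A (Θ ω) j ^ 2) / (2 * v)) k) ∂P)
        (Fintype.card J / 2) (1 / (2 * c * v)) := by
  have hWm : AEMeasurable (fun ω j => W j ω) P :=
    aemeasurable_pi_iff.2 fun j => (hlaw j).aemeasurable
  have hAj : ∀ j, Measurable fun e => A e j := fun j => (measurable_pi_apply j).comp hA
  have hF : Measurable fun p : E × (J → ℝ) => c * ∑ j, (A p.1 j + p.2 j) ^ 2 := by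
    refine Measurable.const_mul (Finset.measurable_sum _ fun j _ => ?_) _
    exact (((hAj j).comp measurable_fst).add
      ((measurable_pi_apply j).comp measurable_snd)).pow_const _
  have hpm : ∀ k, Measurable fun e => ENNReal.ofReal
      (poissonWeight ((∑ j, A e j ^ 2) / (2 * v)) k) := fun k => by
    refine ((continuous_poissonWeight k).measurable.comp (Measurable.div_const ?_ _)).ennreal_ofReal
    exact Finset.measurable_sum _ fun j _ => (hAj j).pow_const _
  have hpair : P.map (fun ω => (Θ ω, fun j => W j ω)) =
      (P.map Θ).prod (P.map fun ω j => W j ω) :=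
    (indepFun_iff_map_prod_eq_prod_map_map hΘ hWm).1 hind
  have := Measure.isProbabilityMeasure_map hWm
  have := Measure.isProbabilityMeasure_map hΘ
  refine Measure.ext fun B hB => ?_
  have e1 : P.map (fun ω => c * ∑ j, (A (Θ ω) j + W j ω) ^ 2) =
      (P.map (fun ω => (Θ ω, fun j => W j ω))).map
        fun p : E × (J → ℝ) => c * ∑ j, (A p.1 j + p.2 j) ^ 2 := by
    rw [AEMeasurable.map_map_of_aemeasurable hF.aemeasurable (hΘ.prodMk hWm)]
    rfl
  rw [e1, Measure.map_apply hF hB, hpair, Measure.prod_apply (hF hB)]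
  -- With the means frozen at e, only the Poisson weights depend on e, so integrating over the law
  -- of Θ averages them alone.
  have e2 : ∀ e, (P.map fun ω j => W j ω)
      (Prod.mk e ⁻¹' ((fun p : E × (J → ℝ) => c * ∑ j, (A p.1 j + p.2 j) ^ 2) ⁻¹' B)) =
      ∑' k : ℕ, ENNReal.ofReal (poissonWeight ((∑ j, A e j ^ 2) / (2 * v)) k) *
        gammaMeasure (Fintype.card J / 2 + k) (1 / (2 * c * v)) B := fun e => by
    have hFe : Measurable fun w : J → ℝ => c * ∑ j, (A e j + w j) ^ 2 := by
      fun_prop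
    have e3 : P.map (fun ω => c * ∑ j, (A e j + W j ω) ^ 2) =
        (P.map fun ω j => W j ω).map fun w : J → ℝ => c * ∑ j, (A e j + w j) ^ 2 := by
      rw [AEMeasurable.map_map_of_aemeasurable hFe.aemeasurable hWm]
      rfl
    rw [map_sum_add_sq_eq_gammaMix hv hc hW hlaw (A e)] at e3
    refine Eq.trans ?_ (gammaMix_apply _ _ _ hB)
    rw [e3, Measure.map_apply hFe hB]
    rfl
  simp_rw [e2]
  rw [lintegral_tsum fun k => ((hpm k).mul_const _).aemeasurable, gammaMix_apply _ _ _ hB]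
  refine tsum_congr fun k => ?_
  rw [lintegral_mul_const _ (hpm k), lintegral_map' (hpm k).aemeasurable hΘ]

end Gaussian

/-! ### The mean of the mixture -/

/-- The k-th component has mean (μ + k)/r and the Poisson mean is s, so the conditional mean is (μ +
s)/r; then ζ has mean 1 and cos θ has mean 0. -/
theorem lintegral_id_gammaMix_weight {K m μ Δ r : ℝ} (hK : 0 ≤ K) (hm : 0 < m) (hμ : 0 < μ)
    (hΔ0 : 0 ≤ Δ) (hΔ1 : Δ ≤ 1) (hr : 0 < r) :
    ∫⁻ x, ENNReal.ofReal x ∂gammaMix (fun k => ENNReal.ofReal (weight K m μ Δ k)) μ r =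
      ENNReal.ofReal (μ * (K + 1) / r) := by
  have := isProbabilityMeasure_gammaMeasure hm hm
  have hs := intensity_nonneg hK hμ hΔ0 hΔ1
  rw [lintegral_gammaMix]
  have e1 : ∀ k : ℕ, ENNReal.ofReal (weight K m μ Δ k) *
      ∫⁻ x, ENNReal.ofReal x ∂gammaMeasure (μ + k) r =
      ∫⁻ a, ENNReal.ofReal (poissonWeight (a.1 * (μ * K * (1 + Δ * Real.cos a.2))) k) *
        ENNReal.ofReal ((μ + k) / r) ∂(gammaMeasure m m).prod uniformPhase := fun k => by
    rw [lintegral_id_gammaMeasure (by positivity) hr, lintegral_mul_const _ (by fun_prop),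
      ofReal_weight hK hm hμ hΔ0 hΔ1]
  simp_rw [e1]
  rw [← lintegral_tsum fun k => by fun_prop]
  have e2 : ∀ᵐ a ∂(gammaMeasure m m).prod uniformPhase,
      ∑' k : ℕ, ENNReal.ofReal (poissonWeight (a.1 * (μ * K * (1 + Δ * Real.cos a.2))) k) *
        ENNReal.ofReal ((μ + k) / r) =
      ENNReal.ofReal (μ / r) +
        ENNReal.ofReal a.1 * ENNReal.ofReal (μ * K * (1 + Δ * Real.cos a.2) / r) := by
    filter_upwards [ae_prod_fst_pos hm] with a ha
    have hsa := mul_nonneg ha.le (hs a.2)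
    set s := a.1 * (μ * K * (1 + Δ * Real.cos a.2)) with hsdef
    have h : HasSum (fun k : ℕ => poissonWeight s k * ((μ + k) / r)) (μ / r + s / r) := by
      have := ((hasSum_poissonWeight s).mul_right μ).add (hasSum_poissonWeight_mul_natCast s)
      rw [show μ / r + s / r = (1 * μ + s) / r by ring]
      exact (this.div_const r).congr_fun fun k => by ring
    have h0 : ∀ k : ℕ, 0 ≤ poissonWeight s k * ((μ + k) / r) := fun k =>
      mul_nonneg (poissonWeight_nonneg hsa k) (by positivity)
    have hsr : s / r = a.1 * (μ * K * (1 + Δ * Real.cos a.2) / r) := by rw [hsdef]; ring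
    rw [tsum_congr fun k : ℕ => (ENNReal.ofReal_mul (poissonWeight_nonneg hsa k)).symm,
      ← ENNReal.ofReal_tsum_of_nonneg h0 h.summable, h.tsum_eq,
      ENNReal.ofReal_add (by positivity) (by positivity), hsr, ENNReal.ofReal_mul ha.le]
  have hcos : ∫ θ, (1 + Δ * Real.cos θ) ∂uniformPhase = 1 := by
    rw [integral_add (integrable_const _) (integrable_uniformPhase (by fun_prop)),
      integral_const_mul, integral_cos_uniformPhase]
    simp
  rw [lintegral_congr_ae e2, lintegral_add_left (by fun_prop), lintegral_const, measure_univ,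
    mul_one, lintegral_prod_mul (f := fun z : ℝ => ENNReal.ofReal z)
      (g := fun θ => ENNReal.ofReal (μ * K * (1 + Δ * Real.cos θ) / r)) (by fun_prop)
      (by fun_prop), lintegral_id_gammaMeasure hm hm,
    div_self hm.ne', ENNReal.ofReal_one, one_mul,
    lintegral_uniformPhase (by fun_prop) fun θ => div_nonneg (hs θ) hr.le, integral_div,
    integral_const_mul, hcos, mul_one, ← ENNReal.ofReal_add (by positivity) (by positivity)]
  congr 1
  ring

/-! ### The physical model -/

/-- By periodicity, translation and reflection of a uniform phase do not affect averages of
functions of its cosine. -/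
theorem lintegral_uniformPhase_cos_sub {f : ℝ → ℝ} (hf : Continuous f) (φ : ℝ) :
    ∫⁻ θ, ENNReal.ofReal (f (Real.cos (φ - θ))) ∂uniformPhase =
      ∫⁻ θ, ENNReal.ofReal (f (Real.cos θ)) ∂uniformPhase := by
  -- The positive part allows the passage to a real integral, as f may take negative values.
  have hmax : ∀ x : ℝ, ENNReal.ofReal (f x) = ENNReal.ofReal (max (f x) 0) := fun x => by
    simp [ENNReal.ofReal_max]
  simp_rw [hmax]
  rw [lintegral_uniformPhase (by fun_prop) fun θ => le_max_right _ _,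
    lintegral_uniformPhase (by fun_prop) fun θ => le_max_right _ _, integral_uniformPhase,
    integral_uniformPhase]
  congr 2
  have hper : Function.Periodic (fun θ => max (f (Real.cos θ)) 0) (2 * Real.pi) := fun θ => by
    simp
  have h := hper.intervalIntegral_add_eq (φ - 2 * Real.pi) 0
  rw [intervalIntegral.integral_comp_sub_left (fun θ => max (f (Real.cos θ)) 0), sub_zero]
  simpa using h

theorem indepFun_of_disjoint_range {Ω ι κ κ' : Type*} [MeasurableSpace Ω] {P : Measure Ω}
    [Fintype κ] [Fintype κ'] {f : ι → Ω → ℝ} (h : iIndepFun f P)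
    (hm : ∀ i, AEMeasurable (f i) P) (e : κ → ι) (e' : κ' → ι) (hd : ∀ i j, e i ≠ e' j) :
    IndepFun (fun ω i => f (e i) ω) (fun ω j => f (e' j) ω) P := by
  classical
  have hST : Disjoint (Finset.univ.image e) (Finset.univ.image e') := by
    rw [Finset.disjoint_left]
    intro x hx hx'
    obtain ⟨i, -, rfl⟩ := Finset.mem_image.1 hx
    obtain ⟨j, -, hj⟩ := Finset.mem_image.1 hx'
    exact hd i j hj.symm
  exact (h.indepFun_finset₀ _ _ hST hm).comp
    (φ := fun x i => x ⟨e i, Finset.mem_image_of_mem e (Finset.mem_univ i)⟩)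
    (ψ := fun x j => x ⟨e' j, Finset.mem_image_of_mem e' (Finset.mem_univ j)⟩)
    (by fun_prop) (by fun_prop)

/-- In-phase and quadrature specular components of all clusters, as a function of the fluctuation
and the phases. -/
def specular {n : ℕ} (V₁ V₂ : ℝ) (U : Fin n → ℝ) (e : Fin 3 ⊕ Fin n → ℝ) :
    Fin (n + 1) ⊕ Fin (n + 1) → ℝ :=
  Sum.elim
    (Fin.cons (Real.sqrt (e (.inl 0)) *
        (V₁ * Real.cos (e (.inl 1)) + V₂ * Real.cos (e (.inl 2))))
      fun i => Real.sqrt (e (.inl 0)) * (U i * Real.cos (e (.inr i))))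
    (Fin.cons (Real.sqrt (e (.inl 0)) *
        (V₁ * Real.sin (e (.inl 1)) + V₂ * Real.sin (e (.inl 2))))
      fun i => Real.sqrt (e (.inl 0)) * (U i * Real.sin (e (.inr i))))

theorem measurable_specular {n : ℕ} (V₁ V₂ : ℝ) (U : Fin n → ℝ) :
    Measurable (specular V₁ V₂ U) := by
  refine measurable_pi_iff.2 ?_
  rintro (j | j) <;> refine Fin.cases ?_ (fun i => ?_) j <;>
    simp only [specular, Sum.elim_inl, Sum.elim_inr, Fin.cons_zero, Fin.cons_succ] <;> fun_prop

/-- By sin² + cos² = 1 the phases of the additional clusters drop out; the first cluster keeps only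
its cross term, through the phase difference. -/
theorem sum_specular_sq {n : ℕ} (V₁ V₂ : ℝ) (U : Fin n → ℝ) {e : Fin 3 ⊕ Fin n → ℝ}
    (he : 0 ≤ e (.inl 0)) :
    ∑ j, specular V₁ V₂ U e j ^ 2 = e (.inl 0) * (V₁ ^ 2 + V₂ ^ 2 + ∑ i, U i ^ 2 +
      2 * V₁ * V₂ * Real.cos (e (.inl 1) - e (.inl 2))) := by
  have h : ∀ i, (Real.sqrt (e (.inl 0)) * (U i * Real.cos (e (.inr i)))) ^ 2 +
      (Real.sqrt (e (.inl 0)) * (U i * Real.sin (e (.inr i)))) ^ 2 = e (.inl 0) * U i ^ 2 :=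
    fun i => by
      simp only [mul_pow, Real.sq_sqrt he]
      linear_combination e (.inl 0) * U i ^ 2 * Real.sin_sq_add_cos_sq (e (.inr i))
  simp only [specular, Fintype.sum_sum_type, Sum.elim_inl, Sum.elim_inr, Fin.sum_univ_succ,
    Fin.cons_zero, Fin.cons_succ]
  rw [add_add_add_comm, ← Finset.sum_add_distrib, Finset.sum_congr rfl fun i _ => h i,
    ← Finset.mul_sum, mul_pow, mul_pow, Real.sq_sqrt he, Real.cos_sub]
  linear_combination e (.inl 0) * V₁ ^ 2 * Real.sin_sq_add_cos_sq (e (.inl 1)) +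
    e (.inl 0) * V₂ ^ 2 * Real.sin_sq_add_cos_sq (e (.inl 2))

theorem power_eq_sum {Ω : Type*} {n : ℕ} (V₁ V₂ : ℝ) (U : Fin n → ℝ) (ζ φ₁ φ₂ : Ω → ℝ)
    (ϑ : Fin n → Ω → ℝ) (X Y : Fin (n + 1) → Ω → ℝ) (ω : Ω) :
    power V₁ V₂ U ζ φ₁ φ₂ ϑ X Y ω =
      ∑ j, (specular V₁ V₂ U (fun i => Sum.elim ![ζ, φ₁, φ₂] ϑ i ω) j + Sum.elim X Y j ω) ^ 2 := by
  simp only [power, specular, Fintype.sum_sum_type, Sum.elim_inl, Sum.elim_inr, Fin.sum_univ_succ,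
    Fin.cons_zero, Fin.cons_succ]
  rw [add_add_add_comm, ← Finset.sum_add_distrib]
  congr 1
  · rw [Complex.sq_norm, Complex.normSq_apply]
    simp [Complex.exp_re, Complex.exp_im]
    ring
  · refine Finset.sum_congr rfl fun i _ => ?_
    rw [Complex.sq_norm, Complex.normSq_apply]
    simp [Complex.exp_re, Complex.exp_im]
    ring

theorem paramΔ_nonneg {n : ℕ} {V₁ V₂ : ℝ} (U : Fin n → ℝ) (h₁ : 0 ≤ V₁) (h₂ : 0 ≤ V₂) :
    0 ≤ paramΔ V₁ V₂ U := by
  unfold paramΔ; positivity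

theorem paramΔ_le_one {n : ℕ} (V₁ V₂ : ℝ) (U : Fin n → ℝ) : paramΔ V₁ V₂ U ≤ 1 := by
  refine div_le_one_of_le₀ ?_ (by positivity)
  have : 0 ≤ ∑ i, U i ^ 2 := by positivity
  nlinarith [sq_nonneg (V₁ - V₂)]

theorem paramK_nonneg {n : ℕ} (σ V₁ V₂ : ℝ) (U : Fin n → ℝ) : 0 ≤ paramK σ V₁ V₂ U := by
  unfold paramK; positivity

theorem specular_intensity {n : ℕ} {σ : ℝ} (hσ : 0 < σ) (V₁ V₂ : ℝ) (U : Fin n → ℝ) (z x : ℝ) :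
    z * (V₁ ^ 2 + V₂ ^ 2 + ∑ i, U i ^ 2 + 2 * V₁ * V₂ * x) / (2 * σ ^ 2) =
      z * (((n : ℝ) + 1) * paramK σ V₁ V₂ U * (1 + paramΔ V₁ V₂ U * x)) := by
  have hU : 0 ≤ ∑ i, U i ^ 2 := by positivity
  unfold paramK paramΔ
  -- When all amplitudes vanish, division by zero makes `paramΔ` equal to 0, and both sides are 0.
  by_cases h : V₁ ^ 2 + V₂ ^ 2 + ∑ i, U i ^ 2 = 0
  · have h1 : V₁ = 0 := by nlinarith [sq_nonneg V₁, sq_nonneg V₂]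
    rw [h, h1]
    simp
  · field_simp

/-- The fluctuation and phases are independent of the 2(n + 1) Gaussian components, which yields
shapes n + 1 + k and rate 1/(2cσ²). To identify the weights, fix ζ and φ₁ and average over φ₂: the
phase difference then acts as one uniform phase. -/
theorem map_power_eq_gammaMix {Ω : Type*} [MeasurableSpace Ω] {P : Measure Ω}
    [IsProbabilityMeasure P] {n : ℕ} {m σ V₁ V₂ c : ℝ} {U : Fin n → ℝ} {ζ φ₁ φ₂ : Ω → ℝ}
    {ϑ : Fin n → Ω → ℝ} {X Y : Fin (n + 1) → Ω → ℝ} (hm : 0 < m) (hσ : 0 < σ) (hc : 0 < c)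
    (h₁ : 0 ≤ V₁) (h₂ : 0 ≤ V₂) (hM : IsModel P m σ ζ φ₁ φ₂ ϑ X Y) :
    P.map (fun ω => c * power V₁ V₂ U ζ φ₁ φ₂ ϑ X Y ω) =
      gammaMix (fun k => ENNReal.ofReal
        (weight (paramK σ V₁ V₂ U) m ((n : ℝ) + 1) (paramΔ V₁ V₂ U) k))
        ((n : ℝ) + 1) (1 / (2 * c * σ ^ 2)) := by
  have hGm := isProbabilityMeasure_gammaMeasure hm hm
  set v : NNReal := (σ ^ 2).toNNReal with hv
  have hvσ : (v : ℝ) = σ ^ 2 := Real.coe_toNNReal _ (by positivity)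
  have hv0 : v ≠ 0 := by rw [← NNReal.coe_ne_zero, hvσ]; positivity
  set f : Fin 3 ⊕ (Fin n ⊕ (Fin (n + 1) ⊕ Fin (n + 1))) → Ω → ℝ :=
    Sum.elim ![ζ, φ₁, φ₂] (Sum.elim ϑ (Sum.elim X Y))
  have hfm : ∀ i, AEMeasurable (f i) P := by
    rintro (i | i | i | i)
    · fin_cases i
      · exact hM.law_fluctuation.aemeasurable
      · exact hM.law_phase₁.aemeasurable
      · exact hM.law_phase₂.aemeasurable
    · exact (hM.law_phase i).aemeasurable
    · exact (hM.law_inPhase i).aemeasurable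
    · exact (hM.law_quadrature i).aemeasurable
  let Θ : Ω → Fin 3 ⊕ Fin n → ℝ := fun ω i => Sum.elim ![ζ, φ₁, φ₂] ϑ i ω
  have hΘf : Θ = fun ω i => f (Sum.map id Sum.inl i) ω := by
    funext ω i; rcases i with i | i <;> rfl
  have hWf : Sum.elim X Y = fun j => f (Sum.inr (Sum.inr j)) := rfl
  have hW : iIndepFun (Sum.elim X Y) P := by
    rw [hWf]
    exact hM.indep.precomp (g := fun j => Sum.inr (Sum.inr j))
      (Sum.inr_injective.comp Sum.inr_injective)
  have hind : IndepFun Θ (fun ω j => Sum.elim X Y j ω) P := by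
    rw [hΘf, hWf]
    refine indepFun_of_disjoint_range hM.indep hfm _ _ ?_
    rintro (i | i) j <;> simp
  have hΘm : AEMeasurable Θ P := by
    rw [hΘf]; exact aemeasurable_pi_iff.2 fun i => hfm _
  have hlaw : ∀ j, HasLaw (Sum.elim X Y j) (gaussianReal 0 v) P := by
    rintro (j | j)
    · exact hM.law_inPhase j
    · exact hM.law_quadrature j
  simp_rw [power_eq_sum]
  rw [map_sum_add_sq_eq_gammaMix_of_indepFun hv0 hc hW hlaw hΘm hind
    (measurable_specular V₁ V₂ U), hvσ]
  have hcard : (Fintype.card (Fin (n + 1) ⊕ Fin (n + 1)) : ℝ) / 2 = n + 1 := by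
    simp
  rw [hcard]
  congr 1
  funext k
  have hζ : ∀ᵐ ω ∂P, 0 < ζ ω := by
    have := ae_gammaMeasure_pos m m
    rw [← hM.law_fluctuation.map_eq] at this
    exact ae_of_ae_map hM.law_fluctuation.aemeasurable this
  set K := paramK σ V₁ V₂ U
  set Δ := paramΔ V₁ V₂ U
  have e1 : ∀ᵐ ω ∂P, ENNReal.ofReal
      (poissonWeight ((∑ j, specular V₁ V₂ U (Θ ω) j ^ 2) / (2 * σ ^ 2)) k) =
      (fun a : (ℝ × ℝ) × ℝ => ENNReal.ofReal
        (poissonWeight (a.2 * (((n : ℝ) + 1) * K * (1 + Δ * Real.cos (a.1.1 - a.1.2)))) k))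
        ((φ₁ ω, φ₂ ω), ζ ω) := by
    filter_upwards [hζ] with ω hω
    rw [sum_specular_sq V₁ V₂ U (e := Θ ω) hω.le, specular_intensity hσ]
    rfl
  have hφ : P.map (fun ω => (φ₁ ω, φ₂ ω)) = uniformPhase.prod uniformPhase := by
    have h := (hM.indep.indepFun (i := .inl 1) (j := .inl 2) (by simp))
    rw [← hM.law_phase₁.map_eq]
    nth_rw 2 [hM.law_phase₁.map_eq]
    rw [← hM.law_phase₂.map_eq]
    exact (indepFun_iff_map_prod_eq_prod_map_map hM.law_phase₁.aemeasurable
      hM.law_phase₂.aemeasurable).1 h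
  have hφm : AEMeasurable (fun ω => (φ₁ ω, φ₂ ω)) P :=
    hM.law_phase₁.aemeasurable.prodMk hM.law_phase₂.aemeasurable
  have hjoint : P.map (fun ω => ((φ₁ ω, φ₂ ω), ζ ω)) =
      (uniformPhase.prod uniformPhase).prod (gammaMeasure m m) := by
    have h := hM.indep.indepFun_prodMk₀ hfm (.inl 1) (.inl 2) (.inl 0) (by simp) (by simp)
    rw [← hφ, ← hM.law_fluctuation.map_eq]
    exact (indepFun_iff_map_prod_eq_prod_map_map hφm hM.law_fluctuation.aemeasurable).1 h
  rw [lintegral_congr_ae e1, ← lintegral_map' (f := fun a : (ℝ × ℝ) × ℝ => ENNReal.ofReal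
      (poissonWeight (a.2 * (((n : ℝ) + 1) * K * (1 + Δ * Real.cos (a.1.1 - a.1.2)))) k))
    (by fun_prop) (hφm.prodMk hM.law_fluctuation.aemeasurable), hjoint,
    ofReal_weight (paramK_nonneg σ V₁ V₂ U) hm (by positivity) (paramΔ_nonneg U h₁ h₂)
      (paramΔ_le_one V₁ V₂ U), lintegral_prod_symm _ (by fun_prop),
    lintegral_prod _ (by fun_prop)]
  refine lintegral_congr fun z => ?_
  rw [lintegral_prod _ (by fun_prop)]
  simp only
  rw [lintegral_congr fun φ => lintegral_uniformPhase_cos_sub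
    (f := fun x => poissonWeight (z * (((n : ℝ) + 1) * K * (1 + Δ * x))) k) (by fun_prop) φ,
    lintegral_const, measure_univ, mul_one]

end MFTR

end

/-! ### The mixture representation in both settings -/

theorem lemma4 :
    -- the physical model, with `μ = n + 1` clusters
    (∀ (Ω : Type*) [MeasurableSpace Ω] (P : Measure Ω) [IsProbabilityMeasure P] (n : ℕ)
        (m σ V₁ V₂ Es N₀ : ℝ) (U : Fin n → ℝ)
        (ζ φ₁ φ₂ : Ω → ℝ) (ϑ : Fin n → Ω → ℝ) (X Y : Fin (n + 1) → Ω → ℝ) (snr : Ω → ℝ)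
        (μ K Δ g : ℝ),
      0 < m → 0 < σ → 0 < Es → 0 < N₀ → 0 ≤ V₁ → 0 ≤ V₂ → (∀ i, 0 ≤ U i) →
      MFTR.IsModel P m σ ζ φ₁ φ₂ ϑ X Y →
      snr = (fun ω => Es / N₀ * MFTR.power V₁ V₂ U ζ φ₁ φ₂ ϑ X Y ω) →
      μ = (n : ℝ) + 1 → K = MFTR.paramK σ V₁ V₂ U → Δ = MFTR.paramΔ V₁ V₂ U →
      g = ∫ ω, snr ω ∂P →
      MFTR.IsGammaMixture (P.map snr) (MFTR.weight K m μ Δ)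
        (fun i => μ + i) (fun i => g * (μ + i) / (μ * (K + 1)))) ∧
    -- the extension to real `μ > 0`, in terms of the shape parameters
    (∀ K m μ Δ g : ℝ, 0 ≤ K → 0 < m → 0 < μ → 0 ≤ Δ → Δ ≤ 1 → 0 < g →
      MFTR.IsGammaMixture (MFTR.mftrLaw K m μ Δ g) (MFTR.weight K m μ Δ)
        (fun i => μ + i) (fun i => g * (μ + i) / (μ * (K + 1)))) := by
  constructor
  · intro Ω _ P _ n m σ V₁ V₂ Es N₀ U ζ φ₁ φ₂ ϑ X Y snr μ K Δ g hm hσ hE hN h₁ h₂ _ hM hsnr hμ hK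
      hΔ hg
    have hc : 0 < Es / N₀ := div_pos hE hN
    have hμ0 : 0 < μ := by rw [hμ]; positivity
    have hK0 : 0 ≤ K := hK ▸ MFTR.paramK_nonneg σ V₁ V₂ U
    have hΔ0 : 0 ≤ Δ := hΔ ▸ MFTR.paramΔ_nonneg U h₁ h₂
    have hΔ1 : Δ ≤ 1 := hΔ ▸ MFTR.paramΔ_le_one V₁ V₂ U
    have hmap := MFTR.map_power_eq_gammaMix (U := U) hm hσ hc h₁ h₂ hM
    rw [← hsnr, ← hμ, ← hK, ← hΔ] at hmap
    have hr : 0 < 1 / (2 * (Es / N₀) * σ ^ 2) := by positivity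
    have hsnr0 : ∀ ω, 0 ≤ snr ω := fun ω => by
      rw [hsnr]; unfold MFTR.power; positivity
    -- Otherwise the image measure would be 0 by convention, whereas `hmap` identifies it with a
    -- probability measure.
    have hsnrm : AEMeasurable snr P := by
      by_contra h
      have hprob := MFTR.isProbabilityMeasure_gammaMix hμ0 hr
        (MFTR.tsum_ofReal_weight hK0 hm hμ0 hΔ0 hΔ1)
      rw [← hmap, Measure.map_of_not_aemeasurable h] at hprob
      exact hprob.ne_zero _ rfl
    -- Evaluating the expectation through the mixture links g to the rate, which so far is expressed
    -- by σ and Es / N₀.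
    have hgval : g = μ * (K + 1) / (1 / (2 * (Es / N₀) * σ ^ 2)) := by
      rw [hg, integral_eq_lintegral_of_nonneg_ae (Filter.Eventually.of_forall hsnr0)
        hsnrm.aestronglyMeasurable,
        ← lintegral_map' (f := fun x => ENNReal.ofReal x) (by fun_prop) hsnrm, hmap,
        MFTR.lintegral_id_gammaMix_weight hK0 hm hμ0 hΔ0 hΔ1 hr,
        ENNReal.toReal_ofReal (by positivity)]
    have hg0 : 0 < g := by rw [hgval]; positivity
    have hrate : 1 / (2 * (Es / N₀) * σ ^ 2) = μ * (K + 1) / g := by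
      rw [hgval, div_div_cancel₀ (by positivity)]
    rw [hmap, hrate]
    exact MFTR.isGammaMixture_gammaMix hμ0 hK0 hg0 (MFTR.weight_nonneg hK0 hm hμ0 hΔ0 hΔ1)
      (MFTR.hasSum_weight hK0 hm hμ0 hΔ0 hΔ1)
  · intro K m μ Δ g hK hm hμ hΔ0 hΔ1 hg
    rw [MFTR.mftrLaw_eq_gammaMix hK hm hμ hΔ0 hΔ1 hg]
    exact MFTR.isGammaMixture_gammaMix hμ hK hg (MFTR.weight_nonneg hK hm hμ hΔ0 hΔ1)
      (MFTR.hasSum_weight hK hm hμ hΔ0 hΔ1)
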